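/- Let $P$ be a probability distribution of a pair $(X,Y)$ on $\mathcal X\times\{0,1\}$, where $\mathcal X$ is a measurable space, with $p=\Pr(Y=1)>0$, and let $(x_1,y_1),(x_2,y_2),\ldots$ be i.i.d. draws from $P$ with $S_n=\{(x_1,y_1),\ldots,(x_n,y_n)\}$. For a ranking function, that is a measurable $f:\mathcal X\to\mathbb R$, let $y^f_{(1)},\ldots,y^f_{(n)}$ be the labels of $S_n$ listed by decreasing score $f(x_i)$, and let $$\mathrm{DCG}(f,S_n)=\sum_{r=1}^n \frac{y^f_{(r)}}{\log(1+r)},\qquad \mathrm{NDCG}(f,S_n)=\frac{\mathrm{DCG}(f,S_n)}{\max_{f'}\mathrm{DCG}(f',S_n)},$$ with $0/0=0$ (standard NDCG). Let $f_0,f_1$ be two ranking functions for which ties have probability zero, i.e. $\Pr[f_i(X)=t]=0$ for every $t\in\mathbb R$ and $i=0,1$. Put $\tilde f_i(x)=\Pr[f_i(X)\le f_i(x)]$ (so that $\tilde f_i(X)$ is uniformly distributed on $[0,1]$), and let $\bar y^{f_i}(s)=\Pr[Y=1\mid \tilde f_i(X)=s]$, $s\in[0,1]$ (any version). Suppose that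 it is not the case that $\bar y^{f_0}(s)=\bar y^{f_1}(s)$ for almost every $s\in[0,1]$. Then: 1. $f_0,f_1$ are distinguishable in expectation by standard NDCG: there are $b\in\{0,1\}$ and a positive integer $N$ such that $\mathbb E[\mathrm{NDCG}(f_b,S_n)]>\mathbb E[\mathrm{NDCG}(f_{1-b},S_n)]$ for all $n\ge N$. 2. If moreover $\bar y^{f_0}$ and $\bar y^{f_1}$ are Hölder continuous on $[0,1]$, each with some exponent $\alpha>0$ and some constant, then $f_0,f_1$ are consistently distinguishable by standard NDCG: there are $b\in\{0,1\}$ and a negligible function $\mathrm{neg}:\mathbb N\to[0,\infty)$ (for every $c$, $\mathrm{neg}(N)<N^{-c}$ for all sufficiently large $N$) such that for every sufficiently large $N$, with probability at least $1-\mathrm{neg}(N)$, the inequality $\mathrm{NDCG}(f_b,S_n)>\mathrm{NDCG}(f_{1-b},S_n)$ holds for all $n\ge N$ simultaneously. -/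

import Mathlib

open MeasureTheory Filter
open scoped NNReal

namespace Ranking

noncomputable section

/-- A data set `S_n = {(x_1, y_1), …, (x_n, y_n)}` of `n` objects from the instance space `𝒳`
with binary relevance labels in `{0, 1}`. -/
abbrev Dataset (𝒳 : Type*) (n : ℕ) : Type _ := Fin n → 𝒳 × Fin 2

/-- A ranking measure assigns a real number to a ranking (scoring) function and a data set. -/
abbrev RankMeasure (𝒳 : Type*) : Type _ := (𝒳 → ℝ) → (n : ℕ) → Dataset 𝒳 n → ℝ

/-- The first `n` terms of an infinite sequence of labelled objects. -/
def firstN {𝒳 : Type*} (z : ℕ → 𝒳 × Fin 2) (n : ℕ) : Dataset 𝒳 n := fun i => z i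

/-- The permutation listing the objects of `S` by decreasing score `f`:
`rankPerm f S r` is the index of the object at (zero-based) position `r`.
Objects with equal scores are listed in the order in which they appear in `S`. -/
def rankPerm {𝒳 : Type*} (f : 𝒳 → ℝ) {n : ℕ} (S : Dataset 𝒳 n) : Equiv.Perm (Fin n) :=
  Tuple.sort (fun i => -f (S i).1)

/-- The relevance `y^f_(r+1)` of the object which `f` puts at zero-based position `r`. -/
def rankedLabel {𝒳 : Type*} (f : 𝒳 → ℝ) {n : ℕ} (S : Dataset 𝒳 n) (r : Fin n) : ℝ :=
  ((S (rankPerm f S r)).2.val : ℝ)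

/-- `DCG_D(f, S_n) = ∑_{r=1}^n y^f_(r) D(r)`; the index `r : Fin n` stands for the rank `r + 1`. -/
def DCG {𝒳 : Type*} (D : ℕ → ℝ) (f : 𝒳 → ℝ) (n : ℕ) (S : Dataset 𝒳 n) : ℝ :=
  ∑ r : Fin n, rankedLabel f S r * D (r.val + 1)

/-- The ideal DCG: the maximum of the DCG over all ranking functions. For a given data set only
finitely many values occur, so that the supremum is a maximum. -/
def IDCG {𝒳 : Type*} (D : ℕ → ℝ) (n : ℕ) (S : Dataset 𝒳 n) : ℝ :=
  ⨆ g : 𝒳 → ℝ, DCG D g n S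

/-- `NDCG_D(f, S_n) = DCG_D(f, S_n) / IDCG_D(S_n)`. -/
def NDCG {𝒳 : Type*} (D : ℕ → ℝ) : RankMeasure 𝒳 :=
  fun f n S => DCG D f n S / IDCG D n S

/-- The discount `D(r) = 1 / log (1 + r)` of standard NDCG. -/
def logDiscount (r : ℕ) : ℝ := 1 / Real.log (1 + r)

/-- The canonical version `f̃(x) = Pr[f(X) ≤ f(x)]` of a ranking function. -/
def canonical {𝒳 : Type*} [MeasurableSpace 𝒳] (P : Measure (𝒳 × Fin 2)) (f : 𝒳 → ℝ) (x : 𝒳) : ℝ :=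
  P.real {z | f z.1 ≤ f x}

/-- `y` is (a version of) the function `s ↦ Pr[Y = 1 | f̃(X) = s]`, that is,
`Pr[Y = 1, f̃(X) ∈ A] = ∫_A y(s) d(law of f̃(X))(s)` for every Borel set `A`. -/
def IsRelevanceCurve {𝒳 : Type*} [MeasurableSpace 𝒳] (P : Measure (𝒳 × Fin 2)) (f : 𝒳 → ℝ)
    (y : ℝ → ℝ) : Prop :=
  Integrable y (P.map (fun z => canonical P f z.1)) ∧
  ∀ A : Set ℝ, MeasurableSet A →
    P.real {z | z.2 = 1 ∧ canonical P f z.1 ∈ A} =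
      ∫ s in A, y s ∂(P.map (fun z => canonical P f z.1))

/-- Hölder continuity on `[0, 1]`, for some positive exponent and some constant. -/
def IsHolderOnUnitInterval (y : ℝ → ℝ) : Prop :=
  ∃ C α : ℝ≥0, 0 < α ∧ HolderOnWith C α y (Set.Icc 0 1)

/-- A negligible function: nonnegative and eventually smaller than every inverse power. -/
def IsNegligible (ν : ℕ → ℝ) : Prop :=
  (∀ N, 0 ≤ ν N) ∧ ∀ c : ℝ, ∀ᶠ N : ℕ in atTop, ν N < (N : ℝ) ^ (-c)

/-- The pair `f 0`, `f 1` is distinguishable in expectation by `M`: for one of them the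
expectation of `M` over `n` i.i.d. draws from `P` is larger for all large `n`. -/
def DistinguishableInExpectation {𝒳 : Type*} [MeasurableSpace 𝒳] (P : Measure (𝒳 × Fin 2))
    (M : RankMeasure 𝒳) (f : Fin 2 → 𝒳 → ℝ) : Prop :=
  ∃ (b : Fin 2) (N : ℕ), 0 < N ∧ ∀ n ≥ N,
    (∀ i, Integrable (fun S : Dataset 𝒳 n => M (f i) n S) (Measure.pi fun _ => P)) ∧
    ∫ S : Dataset 𝒳 n, M (f b) n S ∂(Measure.pi fun _ => P) >
      ∫ S : Dataset 𝒳 n, M (f (1 - b)) n S ∂(Measure.pi fun _ => P)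

/-- The pair `f 0`, `f 1` is consistently distinguishable by `M`: for one of them, for all large
`N`, with probability at least `1 - ν(N)` over an infinite i.i.d. sequence drawn from `P`, the
value of `M` on the first `n` terms is larger for all `n ≥ N` simultaneously; here `ν` is
negligible. -/
def ConsistentlyDistinguishable {𝒳 : Type*} [MeasurableSpace 𝒳] (P : Measure (𝒳 × Fin 2))
    [IsProbabilityMeasure P] (M : RankMeasure 𝒳) (f : Fin 2 → 𝒳 → ℝ) : Prop :=
  ∃ (ν : ℕ → ℝ) (b : Fin 2), IsNegligible ν ∧ ∀ᶠ N : ℕ in atTop,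
    (Measure.infinitePi fun _ : ℕ => P).real
      {z | ∀ n ≥ N, M (f b) n (firstN z n) > M (f (1 - b)) n (firstN z n)} ≥ 1 - ν N

end

end Ranking

/-!
The comparison of two NDCG's is a comparison of two DCG's, since the ideal DCG is the same for both
rankings. Summation by parts (`DCG_eq_sum_topRelevant`) writes the difference of the DCG's as
`∑ (D q - D (q + 1)) (R₀ q - R₁ q)`, with `R_i q` the number of relevant objects among the top `q`
of the `i`-th ranking; all weights are positive and their sum is bounded.

The canonical score `f̃_i(X)` is uniform on `[0, 1]` by the probability integral transform
(`map_canonical`), so the top `q` of `n` objects are roughly those with `f̃_i ≥ 1 - q / n`. Both sets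
are initial segments of the ranking, which reduces the error to two counts of sample points in fixed
sets (`abs_topRelevant_sub_count_le`). Hoeffding's inequality, with a union bound over `q`, gives
`R_i q = n H_i (q / n) + O(n ^ (3 / 4))` for all `q` outside an event of probability
`8 n exp (-2 √n)` (`measure_topRelevant_le`), where `H_i t = Pr[Y = 1, f̃_i(X) ≥ 1 - t]` is
`topMass`. Up to that error the difference of the DCG's is therefore `n` times the deterministic
sum `G n = ∑ (D q - D (q + 1)) W (q / n)` with `W = H₀ - H₁`.

The sum `G n` is close to `∫₀¹ (W t / t) (log n + log t) ^ (-2) dt`. Expanding in powers of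
`1 / log n`, the `j`-th coefficient is `(j + 1)` times the logarithmic moment
`∫₀¹ (W t / t) (-log t) ^ j dt`. If all of these vanished, so would all the power moments
`∫₀¹ W t * t ^ m dt`, as `√t = exp (log t / 2)` is a series in powers of `log t`
(`log_moments_mul_sqrt_eq_zero`); then `W = 0` by Weierstrass, and the relevance curves would agree
almost everywhere (`relevanceCurve_ae_eq`). Hence there is a first nonvanishing moment, of order `j`
say, and `G n` has a constant sign and the exact order `(log n) ^ (-(j + 2))`
(`exists_tendsto_discounted_sum`). This dominates the error `n ^ (-1 / 4)`.

Thus one DCG exceeds the other by a multiple of `n / (log n) ^ (j + 2)` outside an event of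
negligible probability (`exists_measure_DCG_sub_lt_le`). As `0 ≤ NDCG ≤ 1` and the ideal DCG is at
most `n / log 2`, this yields the inequality of expectations; summing the probabilities over `n ≥ N`
yields the comparison for all `n ≥ N` at once, with overwhelming probability.
-/

open Topology ProbabilityTheory Set

/-! ### Logarithmic moments on the unit interval -/

namespace Ranking

/-- The factor `exp (-log t / 2)` is `1 / √t`. -/
lemma integrableOn_inv_sqrt_mul_log_pow (j : ℕ) :
    IntegrableOn (fun t : ℝ => (-Real.log t) ^ j * Real.exp (-Real.log t / 2)) (Ioc 0 1) := by
  have hmeas : Measurable (fun t : ℝ => (-Real.log t) ^ j * Real.exp (-Real.log t / 2)) := by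
    fun_prop
  -- The exponent `e` is so small that `(t ^ (-e)) ^ j * t ^ (-1 / 2) ≤ t ^ (-3 / 4)`.
  set e : ℝ := 1 / (4 * (j + 1)) with he
  have he0 : 0 < e := by positivity
  have hint : IntegrableOn (fun t : ℝ => (1 / e) ^ j * t ^ (-(3 / 4) : ℝ)) (Ioc 0 1) := by
    have := (intervalIntegral.intervalIntegrable_rpow' (a := 0) (b := 1)
      (r := -(3 / 4)) (by norm_num)).const_mul ((1 / e) ^ j)
    rwa [intervalIntegrable_iff_integrableOn_Ioc_of_le zero_le_one] at this
  refine Integrable.mono' hint hmeas.aestronglyMeasurable ?_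
  filter_upwards [ae_restrict_mem measurableSet_Ioc] with t ht
  have ht0 : 0 < t := ht.1
  have hl : 0 ≤ -Real.log t := by
    have := Real.log_nonpos ht.1.le ht.2
    linarith
  have hb := (Real.abs_log_mul_self_rpow_lt t e ht.1 ht.2 he0).le
  have hte : 0 < t ^ e := Real.rpow_pos_of_pos ht.1 e
  have hb' : -Real.log t ≤ 1 / e * t ^ (-e) := by
    rw [Real.rpow_neg ht.1.le, ← div_eq_mul_inv, le_div_iff₀ hte]
    calc _ ≤ |Real.log t * t ^ e| := by rw [neg_mul]; exact neg_le_abs _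
      _ ≤ _ := hb
  have hexp : Real.exp (-Real.log t / 2) = t ^ (-(1 / 2) : ℝ) := by
    rw [Real.rpow_def_of_pos ht.1]; congr 1; ring
  rw [Real.norm_of_nonneg (by positivity), hexp]
  calc (-Real.log t) ^ j * t ^ (-(1 / 2) : ℝ)
      ≤ (1 / e * t ^ (-e)) ^ j * t ^ (-(1 / 2) : ℝ) := by gcongr
    _ = (1 / e) ^ j * t ^ (-e * j + -(1 / 2)) := by
        rw [mul_pow, Real.rpow_add ht.1, Real.rpow_mul_natCast ht.1.le]; ring
    _ ≤ (1 / e) ^ j * t ^ (-(3 / 4) : ℝ) := by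
        gcongr ?_ * ?_
        refine Real.rpow_le_rpow_of_exponent_ge ht.1 ht.2 ?_
        have : e * j ≤ 1 / 4 := by
          rw [he, div_mul_eq_mul_div, div_le_div_iff₀ (by positivity) (by norm_num)]
          linarith
        linarith

lemma integrableOn_neg_log_pow (j : ℕ) :
    IntegrableOn (fun t : ℝ => (-Real.log t) ^ j) (Ioc 0 1) := by
  have hmeas : Measurable (fun t : ℝ => (-Real.log t) ^ j) := by fun_prop
  refine Integrable.mono' (integrableOn_inv_sqrt_mul_log_pow j) hmeas.aestronglyMeasurable ?_
  filter_upwards [ae_restrict_mem measurableSet_Ioc] with t ht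
  have hl : 0 ≤ -Real.log t := by
    have := Real.log_nonpos ht.1.le ht.2
    linarith
  rw [Real.norm_of_nonneg (by positivity)]
  exact le_mul_of_one_le_right (by positivity) (Real.one_le_exp (by positivity))

lemma integrableOn_mul_neg_log_pow {h : ℝ → ℝ} (hm : Measurable h)
    (hb : ∀ t ∈ Ioc (0 : ℝ) 1, |h t| ≤ 1) (j : ℕ) :
    IntegrableOn (fun t : ℝ => h t * (-Real.log t) ^ j) (Ioc 0 1) := by
  refine (integrableOn_neg_log_pow j).bdd_mul (c := 1) hm.aestronglyMeasurable ?_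
  filter_upwards [ae_restrict_mem measurableSet_Ioc] with t ht using hb t ht

/-- Vanishing of the logarithmic moments survives multiplication by `√t = exp (-(-log t) / 2)`:
the exponential series may be integrated term by term, since `t ↦ |log t| ^ j / √t` is integrable. -/
lemma log_moments_mul_sqrt_eq_zero {h : ℝ → ℝ} (hm : Measurable h)
    (hb : ∀ t ∈ Ioc (0 : ℝ) 1, |h t| ≤ 1)
    (h0 : ∀ j : ℕ, ∫ t in Ioc (0 : ℝ) 1, h t * (-Real.log t) ^ j = 0) (j : ℕ) :
    ∫ t in Ioc (0 : ℝ) 1, h t * √t * (-Real.log t) ^ j = 0 := by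
  have hs : HasSum (fun i : ℕ => ∫ t in Ioc (0 : ℝ) 1,
      h t * (-Real.log t) ^ j * ((-(-Real.log t) / 2) ^ i / i.factorial))
      (∫ t in Ioc (0 : ℝ) 1, h t * √t * (-Real.log t) ^ j) := by
    refine hasSum_integral_of_dominated_convergence
      (fun i t => (-Real.log t) ^ j * ((-Real.log t / 2) ^ i / i.factorial)) ?_ ?_ ?_ ?_ ?_
    · intro i
      exact Measurable.aestronglyMeasurable (by fun_prop)
    · intro i
      filter_upwards [ae_restrict_mem measurableSet_Ioc] with t ht
      have hl : 0 ≤ -Real.log t := by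
        have := Real.log_nonpos ht.1.le ht.2
        linarith
      have hn : ‖-(-Real.log t) / 2‖ = -Real.log t / 2 := by
        rw [neg_div, norm_neg, Real.norm_of_nonneg (by positivity)]
      rw [norm_mul, norm_mul, norm_div, norm_pow _ i, hn, norm_pow, Real.norm_of_nonneg hl,
        Real.norm_natCast, Real.norm_eq_abs]
      exact mul_le_mul_of_nonneg_right
        (mul_le_of_le_one_left (by positivity) (hb t ht)) (by positivity)
    · refine Eventually.of_forall fun t => ?_
      exact (Real.summable_pow_div_factorial _).mul_left _
    · refine (integrableOn_inv_sqrt_mul_log_pow j).congr (Eventually.of_forall fun t => ?_)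
      simp only
      rw [tsum_mul_left, Real.exp_eq_exp_ℝ, NormedSpace.exp_eq_tsum_div]
    · filter_upwards [ae_restrict_mem measurableSet_Ioc] with t ht
      have hsq : √t = Real.exp (-(-Real.log t) / 2) := by
        rw [Real.sqrt_eq_rpow, Real.rpow_def_of_pos ht.1]; congr 1; ring
      have h1 := NormedSpace.expSeries_div_hasSum_exp (-(-Real.log t) / 2)
      rw [← Real.exp_eq_exp_ℝ, ← hsq] at h1
      have h2 := h1.mul_left (h t * (-Real.log t) ^ j)
      rwa [mul_right_comm] at h2
  refine hs.unique ?_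
  convert hasSum_zero with i
  have : ∀ t : ℝ, h t * (-Real.log t) ^ j * ((-(-Real.log t) / 2) ^ i / i.factorial)
      = ((-1 / 2) ^ i / i.factorial) * (h t * (-Real.log t) ^ (j + i)) := by
    intro t
    rw [show -(-Real.log t) / 2 = (-1 / 2) * (-Real.log t) by ring, mul_pow, pow_add]
    ring
  simp_rw [this]
  rw [integral_const_mul, h0, mul_zero]

lemma log_moments_mul_sqrt_pow_eq_zero {h : ℝ → ℝ} (hm : Measurable h)
    (hb : ∀ t ∈ Ioc (0 : ℝ) 1, |h t| ≤ 1)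
    (h0 : ∀ j : ℕ, ∫ t in Ioc (0 : ℝ) 1, h t * (-Real.log t) ^ j = 0) (m : ℕ) :
    ∀ j : ℕ, ∫ t in Ioc (0 : ℝ) 1, h t * √t ^ m * (-Real.log t) ^ j = 0 := by
  induction m with
  | zero => simpa using h0
  | succ m ih =>
    intro j
    have := log_moments_mul_sqrt_eq_zero (h := fun t => h t * √t ^ m) (by fun_prop) ?_ ih j
    · simpa only [pow_succ, mul_assoc] using this
    · intro t ht
      rw [abs_mul, abs_pow, abs_of_nonneg (Real.sqrt_nonneg t)]
      exact mul_le_one₀ (hb t ht) (by positivity)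
        (pow_le_one₀ (Real.sqrt_nonneg t) (Real.sqrt_le_one.2 ht.2))

/-- A continuous function on `[0, 1]` all of whose power moments vanish is zero, by the
Weierstrass approximation theorem. -/
lemma eq_zero_of_moments_eq_zero {W : ℝ → ℝ} (hW : Continuous W)
    (h0 : ∀ m : ℕ, ∫ t in Ioc (0 : ℝ) 1, W t * t ^ m = 0) :
    ∀ t ∈ Icc (0 : ℝ) 1, W t = 0 := by
  have hint : ∀ g : ℝ → ℝ, Continuous g → IntegrableOn g (Ioc 0 1) := fun g hg =>
    (hg.continuousOn.integrableOn_Icc (a := 0) (b := 1)).mono_set Ioc_subset_Icc_self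
  have hpoly : ∀ p : Polynomial ℝ, ∫ t in Ioc (0 : ℝ) 1, W t * p.eval t = 0 := by
    intro p
    simp_rw [Polynomial.eval_eq_sum_range, Finset.mul_sum]
    rw [integral_finsetSum]
    · refine Finset.sum_eq_zero fun i _ => ?_
      simp_rw [mul_left_comm (W _)]
      rw [integral_const_mul, h0, mul_zero]
    · intro i _
      exact hint _ (by fun_prop)
  have hsq : ∫ t in Ioc (0 : ℝ) 1, W t * W t = 0 := by
    -- Subtracting from one factor `W` a polynomial within `ε` of it does not change `∫ W ^ 2`.
    have hA : ∀ ε > 0, |∫ t in Ioc (0 : ℝ) 1, W t * W t| ≤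
        ε * ∫ t in Ioc (0 : ℝ) 1, |W t| := by
      intro ε hε
      obtain ⟨p, hp⟩ := exists_polynomial_near_of_continuousOn 0 1 W hW.continuousOn ε hε
      have hi : ∫ t in Ioc (0 : ℝ) 1, W t * W t
          = ∫ t in Ioc (0 : ℝ) 1, W t * (W t - p.eval t) := by
        simp_rw [mul_sub]
        rw [integral_sub, hpoly, sub_zero]
        · exact hint _ (by fun_prop)
        · exact hint _ (hW.mul p.continuous)
      rw [hi, ← integral_const_mul, ← Real.norm_eq_abs]
      refine norm_integral_le_of_norm_le (hint (fun t => ε * |W t|) (by fun_prop)) ?_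
      filter_upwards [ae_restrict_mem measurableSet_Ioc] with t ht
      have := (hp t (Ioc_subset_Icc_self ht)).le
      rw [norm_mul, Real.norm_eq_abs, Real.norm_eq_abs, abs_sub_comm, mul_comm]
      gcongr
    set K := ∫ t in Ioc (0 : ℝ) 1, |W t|
    have ht : Tendsto (fun ε : ℝ => ε * K) (𝓝[>] 0) (𝓝 0) := by
      have : Tendsto (fun ε : ℝ => ε * K) (𝓝 0) (𝓝 (0 * K)) :=
        (continuous_id.mul continuous_const).tendsto 0
      rw [zero_mul] at this
      exact this.mono_left nhdsWithin_le_nhds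
    have := ge_of_tendsto ht (eventually_nhdsWithin_of_forall fun ε hε => hA ε hε)
    exact abs_nonpos_iff.1 this
  rw [integral_eq_zero_iff_of_nonneg (fun t => mul_self_nonneg (W t)) (hint _ (by fun_prop)),
    ← restrict_Ioo_eq_restrict_Ioc] at hsq
  have h1 : EqOn (fun t => W t * W t) 0 (Ioo 0 1) :=
    Measure.eqOn_open_of_ae_eq hsq isOpen_Ioo (by fun_prop) continuousOn_const
  have h2 : EqOn (fun t => W t * W t) 0 (closure (Ioo 0 1)) :=
    h1.closure (by fun_prop) continuous_const
  rw [closure_Ioo zero_ne_one] at h2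
  intro t ht
  exact mul_self_eq_zero.1 (h2 ht)

end Ranking

/-! ### Asymptotics of discounted sums -/

namespace Ranking

/-- The `k`-th Taylor remainder of `L ^ (k + 2) / (L - l) ^ 2`, as a function of `l`, in closed
form. -/
lemma pow_div_sq_sub_sum_eq (k : ℕ) {L l : ℝ} (h : l < L) :
    L ^ (k + 2) / (L - l) ^ 2 - ∑ j ∈ Finset.range k, ((j : ℝ) + 1) * l ^ j * L ^ (k - j)
      = l ^ k * ((k + 1) * L ^ 2 - k * l * L) / (L - l) ^ 2 := by
  have hs : ∀ k : ℕ, (L - l) ^ 2 * ∑ j ∈ Finset.range k, ((j : ℝ) + 1) * l ^ j * L ^ (k - j)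
      = L ^ (k + 2) - l ^ k * ((k + 1) * L ^ 2 - k * l * L) := by
    intro k
    induction k with
    | zero => simp
    | succ k ih =>
      have : ∑ j ∈ Finset.range k, ((j : ℝ) + 1) * l ^ j * L ^ (k + 1 - j)
          = L * ∑ j ∈ Finset.range k, ((j : ℝ) + 1) * l ^ j * L ^ (k - j) := by
        rw [Finset.mul_sum]
        refine Finset.sum_congr rfl fun j hj => ?_
        rw [Nat.succ_sub (Finset.mem_range.1 hj).le, pow_succ]
        ring
      rw [Finset.sum_range_succ, this, mul_add, mul_left_comm, ih]
      have h1 : k + 1 - k = 1 := by omega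
      rw [h1]
      push_cast
      ring
  have hne : (L - l) ^ 2 ≠ 0 := pow_ne_zero _ (sub_ne_zero.2 h.ne')
  rw [eq_div_iff hne, sub_mul, div_mul_cancel₀ _ hne, mul_comm _ ((L - l) ^ 2), hs]
  ring

/-- The integrable majorant, in terms of `l = -log t`, for the rescaled remainders. -/
noncomputable def logMajorant (k : ℕ) (l : ℝ) : ℝ :=
  (k + 1) * (4 * l ^ k + 4 / Real.log 2 ^ 2 * l ^ (k + 2)) + k * k * 2 ^ k * l ^ k

lemma abs_remainder_le (k : ℕ) {L l : ℝ} (hl : 0 ≤ l) (h : Real.log 2 ≤ L - l) :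
    |L ^ (k + 2) / (L - l) ^ 2 - ∑ j ∈ Finset.range k, ((j : ℝ) + 1) * l ^ j * L ^ (k - j)|
      ≤ logMajorant k l := by
  have hlog : 0 < Real.log 2 := Real.log_pos one_lt_two
  have hd : 0 < L - l := hlog.trans_le h
  have hL : 0 < L := by linarith
  rw [pow_div_sq_sub_sum_eq k (by linarith)]
  have hk : (0 : ℝ) ≤ k := k.cast_nonneg
  have h1 : 0 ≤ (k + 1) * L ^ 2 - k * l * L := by nlinarith [mul_nonneg hk hL.le, sq_nonneg L]
  have h2 : (k + 1) * L ^ 2 - k * l * L ≤ (k + 1) * L ^ 2 := by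
    have : 0 ≤ k * l * L := by positivity
    linarith
  have h3 : L ^ 2 / (L - l) ^ 2 ≤ 4 + 4 / Real.log 2 ^ 2 * l ^ 2 := by
    rcases le_total l (L / 2) with h' | h'
    · have : L ^ 2 / (L - l) ^ 2 ≤ 4 := by
        rw [div_le_iff₀ (by positivity)]
        nlinarith
      have : 0 ≤ 4 / Real.log 2 ^ 2 * l ^ 2 := by positivity
      linarith
    · have : L ^ 2 / (L - l) ^ 2 ≤ (2 * l) ^ 2 / Real.log 2 ^ 2 := by
        gcongr
        linarith
      calc _ ≤ _ := this
        _ = 4 / Real.log 2 ^ 2 * l ^ 2 := by ring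
        _ ≤ _ := by linarith
  rw [abs_of_nonneg (by positivity)]
  calc l ^ k * ((k + 1) * L ^ 2 - k * l * L) / (L - l) ^ 2
      ≤ l ^ k * ((k + 1) * L ^ 2) / (L - l) ^ 2 := by gcongr
    _ = l ^ k * (k + 1) * (L ^ 2 / (L - l) ^ 2) := by ring
    _ ≤ l ^ k * (k + 1) * (4 + 4 / Real.log 2 ^ 2 * l ^ 2) := by gcongr
    _ = (k + 1) * (4 * l ^ k + 4 / Real.log 2 ^ 2 * l ^ (k + 2)) := by ring
    _ ≤ _ := le_add_of_nonneg_right (by positivity)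

/-- The majorant also bounds the Taylor polynomial alone where `l` is comparable to `L`. -/
lemma abs_taylor_sum_le (k : ℕ) {L l : ℝ} (hL : 0 ≤ L) (h : L ≤ 2 * l) :
    |∑ j ∈ Finset.range k, ((j : ℝ) + 1) * l ^ j * L ^ (k - j)| ≤ logMajorant k l := by
  have hl : 0 ≤ l := by linarith
  rw [abs_of_nonneg (by positivity)]
  calc ∑ j ∈ Finset.range k, ((j : ℝ) + 1) * l ^ j * L ^ (k - j)
      ≤ ∑ j ∈ Finset.range k, (k : ℝ) * 2 ^ k * l ^ k := by
        refine Finset.sum_le_sum fun j hj => ?_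
        have hj' := Finset.mem_range.1 hj
        have h1 : (j : ℝ) + 1 ≤ k := by exact_mod_cast hj'
        calc ((j : ℝ) + 1) * l ^ j * L ^ (k - j) ≤ k * l ^ j * (2 * l) ^ (k - j) := by gcongr
          _ = k * 2 ^ (k - j) * (l ^ j * l ^ (k - j)) := by rw [mul_pow]; ring
          _ = k * 2 ^ (k - j) * l ^ k := by rw [← pow_add, Nat.add_sub_cancel' hj'.le]
          _ ≤ k * 2 ^ k * l ^ k := by
            gcongr
            · exact one_le_two
            · exact Nat.sub_le k j
    _ = k * k * 2 ^ k * l ^ k := by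
        rw [Finset.sum_const, Finset.card_range, nsmul_eq_mul]; ring
    _ ≤ _ := le_add_of_nonneg_left (by positivity)

lemma tendsto_remainder (k : ℕ) (l : ℝ) :
    Tendsto (fun L : ℝ => L ^ (k + 2) / (L - l) ^ 2
      - ∑ j ∈ Finset.range k, ((j : ℝ) + 1) * l ^ j * L ^ (k - j)) atTop
      (𝓝 ((k + 1) * l ^ k)) := by
  have h0 : Tendsto (fun L : ℝ => l / L) atTop (𝓝 0) := tendsto_const_nhds.div_atTop tendsto_id
  have h1 : Tendsto (fun L : ℝ => l ^ k * ((k + 1) - k * (l / L)) / (1 - l / L) ^ 2) atTop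
      (𝓝 (l ^ k * ((k + 1) - k * 0) / (1 - 0) ^ 2)) :=
    (((tendsto_const_nhds.sub (h0.const_mul _)).const_mul _)).div
      ((tendsto_const_nhds.sub h0).pow 2) (by norm_num)
  have h2 : l ^ k * (((k : ℝ) + 1) - k * 0) / (1 - 0) ^ 2 = (k + 1) * l ^ k := by ring
  rw [h2] at h1
  refine h1.congr' ?_
  filter_upwards [eventually_gt_atTop l, eventually_gt_atTop 0] with L hL hL0
  have : L - l ≠ 0 := sub_ne_zero.2 hL.ne'
  rw [pow_div_sq_sub_sum_eq k hL]
  have h3 : 1 - l / L = (L - l) / L := by field_simp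
  rw [h3]
  field_simp

/-- If the logarithmic moments of `h` of order less than `k` vanish, then
`∫ h(t) / (L + log t) ^ 2` is asymptotic to `(k + 1) M_k / L ^ (k + 2)`, where `L = log n` and `M_k`
is the `k`-th moment: subtracting the vanishing terms of the Taylor expansion of
`1 / (L - l) ^ 2` at `l = 0` leaves an integrand that is dominated after rescaling. -/
lemma tendsto_log_pow_mul_integral {h : ℝ → ℝ} (hm : Measurable h)
    (hb : ∀ t ∈ Ioc (0 : ℝ) 1, |h t| ≤ 1) (k : ℕ)
    (h0 : ∀ j < k, ∫ t in Ioc (0 : ℝ) 1, h t * (-Real.log t) ^ j = 0) :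
    Tendsto (fun n : ℕ => Real.log n ^ (k + 2) * ∫ t in Ioc (0 : ℝ) 1,
        (Ioi (2 / (n : ℝ))).indicator (fun t => h t / (Real.log n + Real.log t) ^ 2) t) atTop
      (𝓝 ((k + 1) * ∫ t in Ioc (0 : ℝ) 1, h t * (-Real.log t) ^ k)) := by
  have hlog : 0 < Real.log 2 := Real.log_pos one_lt_two
  have hLtop : Tendsto (fun n : ℕ => Real.log n) atTop atTop :=
    Real.tendsto_log_atTop.comp tendsto_natCast_atTop_atTop
  have hgap : ∀ (n : ℕ) (t : ℝ), 4 ≤ n → 2 / (n : ℝ) < t →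
      Real.log 2 ≤ Real.log n - -Real.log t := by
    intro n t hn ht
    have hn0 : (0 : ℝ) < n := by exact_mod_cast (by omega : 0 < n)
    have ht0 : 0 < t := lt_trans (by positivity) ht
    rw [sub_neg_eq_add, ← Real.log_mul hn0.ne' ht0.ne']
    refine Real.log_le_log two_pos ?_
    rw [div_lt_iff₀ hn0] at ht
    linarith
  -- The rescaled integrand after subtraction of the terms that integrate to zero.
  set F : ℕ → ℝ → ℝ := fun n t =>
    h t * ((Ioi (2 / (n : ℝ))).indicator
      (fun t => Real.log n ^ (k + 2) / (Real.log n - -Real.log t) ^ 2) t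
      - ∑ j ∈ Finset.range k, ((j : ℝ) + 1) * (-Real.log t) ^ j * Real.log n ^ (k - j)) with hF
  have hFm : ∀ n, Measurable (F n) := by
    intro n
    refine hm.mul (Measurable.sub (Measurable.indicator (by fun_prop) measurableSet_Ioi) ?_)
    fun_prop
  have hbound : ∀ n : ℕ, 4 ≤ n → ∀ᵐ t ∂(volume.restrict (Ioc (0 : ℝ) 1)),
      ‖F n t‖ ≤ logMajorant k (-Real.log t) := by
    intro n hn
    have hn0 : (0 : ℝ) < n := by exact_mod_cast (by omega : 0 < n)
    filter_upwards [ae_restrict_mem measurableSet_Ioc] with t ht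
    have hl : 0 ≤ -Real.log t := by
      have := Real.log_nonpos ht.1.le ht.2
      linarith
    have hL4 : 2 * Real.log 2 ≤ Real.log n := by
      rw [← Real.log_rpow two_pos]
      refine Real.log_le_log (by positivity) ?_
      norm_num
      exact_mod_cast hn
    rw [hF, norm_mul]
    refine (mul_le_of_le_one_left (norm_nonneg _) (hb t ht)).trans ?_
    -- For `t > 2 / n` the denominator is at least `log 2`; below, only the Taylor terms are left, and
    -- there `-log t ≥ log n / 2`.
    by_cases hc : 2 / (n : ℝ) < t
    · rw [indicator_of_mem (show t ∈ Ioi (2 / (n : ℝ)) from hc)]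
      exact abs_remainder_le k hl (hgap n t hn hc)
    · rw [indicator_of_notMem (show t ∉ Ioi (2 / (n : ℝ)) from hc), zero_sub, norm_neg]
      refine abs_taylor_sum_le k (by linarith) ?_
      have := Real.log_le_log ht.1 (not_lt.1 hc)
      rw [Real.log_div two_ne_zero hn0.ne'] at this
      linarith
  have hMint : IntegrableOn (fun t => logMajorant k (-Real.log t)) (Ioc 0 1) := by
    unfold logMajorant
    exact ((((integrableOn_neg_log_pow k).const_mul 4).add
      ((integrableOn_neg_log_pow (k + 2)).const_mul _)).const_mul _).add
      ((integrableOn_neg_log_pow k).const_mul _)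
  have hlim : Tendsto (fun n => ∫ t in Ioc (0 : ℝ) 1, F n t) atTop
      (𝓝 (∫ t in Ioc (0 : ℝ) 1, h t * ((k + 1) * (-Real.log t) ^ k))) := by
    refine tendsto_integral_filter_of_dominated_convergence _
      (Eventually.of_forall fun n => (hFm n).aestronglyMeasurable)
      ((eventually_ge_atTop 4).mono hbound) hMint ?_
    filter_upwards [ae_restrict_mem measurableSet_Ioc] with t ht
    refine (((tendsto_remainder k (-Real.log t)).comp hLtop).const_mul (h t)).congr' ?_
    have h2 : Tendsto (fun n : ℕ => 2 / (n : ℝ)) atTop (𝓝 0) :=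
      tendsto_const_div_atTop_nhds_zero_nat 2
    filter_upwards [h2.eventually_lt_const ht.1] with n hn
    simp only [hF, Function.comp]
    rw [indicator_of_mem (show t ∈ Ioi (2 / (n : ℝ)) from hn)]
  have hval : ∫ t in Ioc (0 : ℝ) 1, h t * ((k + 1) * (-Real.log t) ^ k)
      = (k + 1) * ∫ t in Ioc (0 : ℝ) 1, h t * (-Real.log t) ^ k := by
    rw [← integral_const_mul]
    congr 1; ext t; ring
  rw [hval] at hlim
  refine hlim.congr' ?_
  filter_upwards [eventually_ge_atTop 4] with n hn
  have hS : ∀ t, h t * ∑ j ∈ Finset.range k,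
      ((j : ℝ) + 1) * (-Real.log t) ^ j * Real.log n ^ (k - j)
      = ∑ j ∈ Finset.range k, (((j : ℝ) + 1) * Real.log n ^ (k - j)) *
        (h t * (-Real.log t) ^ j) := by
    intro t
    rw [Finset.mul_sum]
    exact Finset.sum_congr rfl fun j _ => by ring
  have hSint : ∀ j ∈ Finset.range k, Integrable (fun t => (((j : ℝ) + 1) * Real.log n ^ (k - j)) *
        (h t * (-Real.log t) ^ j)) (volume.restrict (Ioc 0 1)) := fun j _ =>
    (integrableOn_mul_neg_log_pow hm hb j).const_mul _
  have hS0 : ∫ t in Ioc (0 : ℝ) 1, h t * ∑ j ∈ Finset.range k,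
      ((j : ℝ) + 1) * (-Real.log t) ^ j * Real.log n ^ (k - j) = 0 := by
    simp_rw [hS]
    rw [integral_finsetSum _ hSint]
    refine Finset.sum_eq_zero fun j hj => ?_
    rw [integral_const_mul, h0 j (Finset.mem_range.1 hj), mul_zero]
  have hFint : Integrable (F n) (volume.restrict (Ioc 0 1)) :=
    Integrable.mono' hMint (hFm n).aestronglyMeasurable (hbound n hn)
  have hadd : ∀ t, Real.log n ^ (k + 2) *
      (Ioi (2 / (n : ℝ))).indicator (fun t => h t / (Real.log n + Real.log t) ^ 2) t
      = F n t + h t * ∑ j ∈ Finset.range k,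
        ((j : ℝ) + 1) * (-Real.log t) ^ j * Real.log n ^ (k - j) := by
    intro t
    simp only [hF]
    by_cases hc : t ∈ Ioi (2 / (n : ℝ))
    · rw [indicator_of_mem hc, indicator_of_mem hc, sub_neg_eq_add]
      ring
    · rw [indicator_of_notMem hc, indicator_of_notMem hc]
      ring
  rw [← integral_const_mul]
  simp_rw [hadd]
  rw [integral_add hFint, hS0, add_zero]
  simp_rw [hS]
  exact integrable_finsetSum _ hSint

lemma logDiscount_sub_eq_integral {q : ℕ} (hq : 1 ≤ q) :
    logDiscount q - logDiscount (q + 1)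
      = ∫ x in ((q : ℝ) + 1)..((q + 1 : ℕ) : ℝ) + 1, 1 / (x * Real.log x ^ 2) := by
  have hq' : (1 : ℝ) ≤ q := by exact_mod_cast hq
  have hx : ∀ x ∈ uIcc ((q : ℝ) + 1) (((q + 1 : ℕ) : ℝ) + 1), 2 ≤ x := by
    intro x hx
    rw [uIcc_of_le (by push_cast; linarith)] at hx
    linarith [hx.1]
  rw [intervalIntegral.integral_eq_sub_of_hasDerivAt (f := fun x => -(Real.log x)⁻¹)]
  · simp only [logDiscount]
    rw [add_comm (1 : ℝ), add_comm (1 : ℝ)]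
    ring
  · intro x hx'
    have h2 := hx x hx'
    have hl : Real.log x ≠ 0 := (Real.log_pos (by linarith)).ne'
    have hd := ((Real.hasDerivAt_log (by linarith : x ≠ 0)).inv hl).neg
    have he : 1 / (x * Real.log x ^ 2) = -(-x⁻¹ / Real.log x ^ 2) := by
      have h0 : x ≠ 0 := by linarith
      field_simp
    rw [he]
    exact hd
  · refine ContinuousOn.intervalIntegrable fun x hx' => ContinuousAt.continuousWithinAt ?_
    have h2 := hx x hx'
    have hl : Real.log x ≠ 0 := (Real.log_pos (by linarith)).ne'
    have h0 : x ≠ 0 := by linarith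
    exact continuousAt_const.div (continuousAt_id.mul ((Real.continuousAt_log h0).pow 2))
      (mul_ne_zero h0 (pow_ne_zero 2 hl))

lemma logDiscount_pos {q : ℕ} (hq : 1 ≤ q) : 0 < logDiscount q := by
  have hq' : (1 : ℝ) ≤ q := by exact_mod_cast hq
  exact one_div_pos.2 (Real.log_pos (by linarith))

lemma logDiscount_succ_le {q : ℕ} (hq : 1 ≤ q) : logDiscount (q + 1) ≤ logDiscount q := by
  have hq' : (1 : ℝ) ≤ q := by exact_mod_cast hq
  refine one_div_le_one_div_of_le (Real.log_pos (by linarith))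
    (Real.log_le_log (by linarith) ?_)
  push_cast
  linarith

lemma logDiscount_le {q : ℕ} (hq : 1 ≤ q) : logDiscount q ≤ logDiscount 1 := by
  induction q, hq using Nat.le_induction with
  | base => exact le_rfl
  | succ q hq ih => exact (logDiscount_succ_le hq).trans ih

lemma sum_logDiscount_sub_le (n : ℕ) :
    ∑ q ∈ Finset.Ico 1 n, (logDiscount q - logDiscount (q + 1)) ≤ logDiscount 1 := by
  rcases Nat.lt_or_ge n 1 with hn | hn
  · rw [Finset.Ico_eq_empty_of_le hn.le, Finset.sum_empty]
    exact (logDiscount_pos le_rfl).le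
  · have := Finset.sum_Ico_sub (fun q => -logDiscount q) hn
    simp only [sub_neg_eq_add, neg_add_eq_sub] at this
    rw [this]
    linarith [logDiscount_pos hn]

/-- Comparison of a discounted sum with the corresponding integral. -/
lemma abs_discounted_sum_sub_integral_le {W : ℝ → ℝ} (hW : LipschitzWith 1 W) {n : ℕ}
    (hn : 1 ≤ n) :
    |∑ q ∈ Finset.Ico 1 n, (logDiscount q - logDiscount (q + 1)) * W (q / n)
      - ∫ x in (2 : ℝ)..n + 1, W (x / n) * (1 / (x * Real.log x ^ 2))|
      ≤ 2 * logDiscount 1 / n := by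
  have hn0 : (0 : ℝ) < n := by exact_mod_cast hn
  have hcont : ∀ q : ℕ, 1 ≤ q → ContinuousOn (fun x : ℝ => 1 / (x * Real.log x ^ 2))
      (uIcc ((q : ℝ) + 1) (((q + 1 : ℕ) : ℝ) + 1)) := by
    intro q hq x hx'
    have hq' : (1 : ℝ) ≤ q := by exact_mod_cast hq
    rw [uIcc_of_le (by push_cast; linarith)] at hx'
    have hx1 := hx'.1
    have hl : Real.log x ≠ 0 := (Real.log_pos (by linarith)).ne'
    have h0 : x ≠ 0 := by linarith
    exact (continuousAt_const.div (continuousAt_id.mul ((Real.continuousAt_log h0).pow 2))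
      (mul_ne_zero h0 (pow_ne_zero 2 hl))).continuousWithinAt
  have hWc : Continuous (fun x : ℝ => W (x / n)) := hW.continuous.comp (by fun_prop)
  have hint : ∀ q : ℕ, 1 ≤ q → IntervalIntegrable
      (fun x : ℝ => W (x / n) * (1 / (x * Real.log x ^ 2))) volume
      ((q : ℝ) + 1) (((q + 1 : ℕ) : ℝ) + 1) := fun q hq =>
    (hWc.continuousOn.mul (hcont q hq)).intervalIntegrable
  have hsum := intervalIntegral.sum_integral_adjacent_intervals_Ico (μ := volume)
    (f := fun x : ℝ => W (x / n) * (1 / (x * Real.log x ^ 2))) (a := fun q : ℕ => (q : ℝ) + 1)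
    hn (fun q hq => hint q (mem_Ico.1 hq).1)
  have h11 : ((1 : ℕ) : ℝ) + 1 = 2 := by norm_num
  rw [h11] at hsum
  rw [← hsum, ← Finset.sum_sub_distrib]
  calc |∑ q ∈ Finset.Ico 1 n, ((logDiscount q - logDiscount (q + 1)) * W (q / n)
        - ∫ x in ((q : ℝ) + 1)..((q + 1 : ℕ) : ℝ) + 1,
          W (x / n) * (1 / (x * Real.log x ^ 2)))|
      ≤ ∑ q ∈ Finset.Ico 1 n, |(logDiscount q - logDiscount (q + 1)) * W (q / n)
        - ∫ x in ((q : ℝ) + 1)..((q + 1 : ℕ) : ℝ) + 1,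
          W (x / n) * (1 / (x * Real.log x ^ 2))| := Finset.abs_sum_le_sum_abs _ _
    _ ≤ ∑ q ∈ Finset.Ico 1 n, 2 / n * (logDiscount q - logDiscount (q + 1)) := by
        refine Finset.sum_le_sum fun q hq => ?_
        have hq1 := (Finset.mem_Ico.1 hq).1
        have hq' : (1 : ℝ) ≤ q := by exact_mod_cast hq1
        have hI := (hcont q hq1).intervalIntegrable (μ := volume)
        rw [logDiscount_sub_eq_integral hq1, mul_comm, ← intervalIntegral.integral_const_mul,
          ← intervalIntegral.integral_sub (hI.const_mul _) (hint q hq1),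
          ← intervalIntegral.integral_const_mul, ← Real.norm_eq_abs]
        have hle : (q : ℝ) + 1 ≤ ((q + 1 : ℕ) : ℝ) + 1 := by push_cast; linarith
        refine intervalIntegral.norm_integral_le_of_norm_le hle ?_ (hI.const_mul _)
        refine Eventually.of_forall fun x hx => ?_
        have hx1 := hx.1.le
        have hx2 := hx.2
        push_cast at hx2
        have hx0 : 0 < x := by linarith
        rw [← sub_mul, norm_mul, Real.norm_of_nonneg (r := 1 / (x * Real.log x ^ 2))
          (by positivity)]
        refine mul_le_mul_of_nonneg_right ?_ (by positivity)
        have := hW.dist_le_mul (q / n) (x / n)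
        rw [NNReal.coe_one, one_mul, Real.dist_eq, Real.dist_eq, ← sub_div, abs_div,
          abs_of_pos hn0] at this
        refine this.trans ?_
        gcongr
        rw [abs_le]
        constructor <;> linarith
    _ ≤ 2 / n * logDiscount 1 := by
        rw [← Finset.mul_sum]
        exact mul_le_mul_of_nonneg_left (sum_logDiscount_sub_le n) (by positivity)
    _ = 2 * logDiscount 1 / n := by ring

/-- The substitution `x = n t`; the part of the range beyond `t = 1` does not contribute. -/
lemma integral_rescale {W : ℝ → ℝ} (h1 : ∀ t, 1 ≤ t → W t = 0) {n : ℕ} (hn : 2 ≤ n) :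
    ∫ x in (2 : ℝ)..n + 1, W (x / n) * (1 / (x * Real.log x ^ 2))
      = ∫ t in Ioc (0 : ℝ) 1, (Ioi (2 / (n : ℝ))).indicator
        (fun t => W t / t / (Real.log n + Real.log t) ^ 2) t := by
  have hn2 : (2 : ℝ) ≤ n := by exact_mod_cast hn
  have hn0 : (0 : ℝ) < n := by linarith
  have hs : Ioc (0 : ℝ) 1 ∩ Ioi (2 / (n : ℝ)) = Ioc (2 / (n : ℝ)) 1 := by
    ext t
    have : 0 < 2 / (n : ℝ) := by positivity
    simp only [mem_inter_iff, mem_Ioc, mem_Ioi]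
    constructor
    · rintro ⟨⟨_, h⟩, h'⟩; exact ⟨h', h⟩
    · rintro ⟨h, h'⟩; exact ⟨⟨this.trans h, h'⟩, h⟩
  have h11 : (1 : ℝ) ≤ (n + 1) / n := by rw [le_div_iff₀ hn0]; linarith
  rw [setIntegral_indicator measurableSet_Ioi, hs,
    ← setIntegral_eq_of_subset_of_forall_sdiff_eq_zero measurableSet_Ioc
      (Ioc_subset_Ioc_right h11), ← intervalIntegral.integral_of_le]
  · have := intervalIntegral.integral_comp_mul_left (a := 2 / (n : ℝ)) (b := (n + 1) / n)
      (fun x => W (x / n) * (1 / (x * Real.log x ^ 2))) hn0.ne'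
    rw [mul_div_cancel₀ _ hn0.ne', mul_div_cancel₀ _ hn0.ne', smul_eq_mul,
      eq_inv_mul_iff_mul_eq₀ hn0.ne', ← intervalIntegral.integral_const_mul] at this
    rw [← this]
    refine intervalIntegral.integral_congr fun t ht => ?_
    have hle : 2 / (n : ℝ) ≤ (n + 1) / n := by gcongr; linarith
    rw [uIcc_of_le hle] at ht
    have ht0 : 0 < t := lt_of_lt_of_le (by positivity) ht.1
    rw [mul_div_cancel_left₀ _ hn0.ne', Real.log_mul hn0.ne' ht0.ne', one_div, mul_inv, mul_inv]
    field_simp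
  · gcongr; linarith
  · rintro t ⟨ht, ht'⟩
    have : 1 ≤ t := by
      by_contra hc
      exact ht' ⟨ht.1, (not_le.1 hc).le⟩
    rw [h1 t this]
    simp

/-- A nonzero `W` has a first nonvanishing logarithmic moment, and its order is the order, in powers
of `1 / log n`, of the discounted sums of `W`. -/
theorem exists_tendsto_discounted_sum {W : ℝ → ℝ} (hW : LipschitzWith 1 W) (hW0 : W 0 = 0)
    (hW1 : ∀ t, 1 ≤ t → W t = 0) (hne : ∃ t ∈ Icc (0 : ℝ) 1, W t ≠ 0) :
    ∃ (k : ℕ) (c : ℝ), c ≠ 0 ∧ Tendsto (fun n : ℕ => Real.log n ^ k *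
      ∑ q ∈ Finset.Ico 1 n, (logDiscount q - logDiscount (q + 1)) * W (q / n)) atTop (𝓝 c) := by
  have hm : Measurable (fun t => W t / t) := hW.continuous.measurable.div measurable_id
  have hb : ∀ t ∈ Ioc (0 : ℝ) 1, |W t / t| ≤ 1 := by
    intro t ht
    have := hW.dist_le_mul t 0
    rw [NNReal.coe_one, one_mul, Real.dist_eq, Real.dist_eq, hW0, sub_zero, sub_zero] at this
    rw [abs_div]
    exact div_le_one_of_le₀ this (abs_nonneg t)
  have hex : ∃ j : ℕ, ∫ t in Ioc (0 : ℝ) 1, W t / t * (-Real.log t) ^ j ≠ 0 := by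
    by_contra! hcon
    obtain ⟨t, ht, htne⟩ := hne
    refine htne (eq_zero_of_moments_eq_zero hW.continuous (fun m => ?_) t ht)
    -- The factor `√t ^ (2 * (m + 1)) = t ^ (m + 1)` turns the weight `W t / t` into `W t * t ^ m`.
    have := log_moments_mul_sqrt_pow_eq_zero hm hb hcon (2 * (m + 1)) 0
    refine Eq.trans (setIntegral_congr_fun measurableSet_Ioc fun s hs => ?_) this
    have hs0 : 0 < s := hs.1
    rw [pow_mul, Real.sq_sqrt hs0.le, pow_succ, pow_zero]
    field_simp
  classical
  set k := Nat.find hex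
  refine ⟨k + 2, (k + 1) * ∫ t in Ioc (0 : ℝ) 1, W t / t * (-Real.log t) ^ k,
    mul_ne_zero (by positivity) (Nat.find_spec hex), ?_⟩
  have hmain := tendsto_log_pow_mul_integral hm hb k
    (fun j hj => not_not.1 (Nat.find_min hex hj))
  have herr : Tendsto (fun n : ℕ => Real.log n ^ (k + 2) * (2 * logDiscount 1 / n)) atTop
      (𝓝 0) := by
    have h := (Real.isLittleO_pow_log_id_atTop (n := k + 2)).tendsto_div_nhds_zero.comp
      tendsto_natCast_atTop_atTop
    have h' := h.const_mul (2 * logDiscount 1)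
    rw [mul_zero] at h'
    refine h'.congr fun n => ?_
    simp only [Function.comp, id]
    ring
  have hdiff : Tendsto (fun n : ℕ => Real.log n ^ (k + 2) *
      (∑ q ∈ Finset.Ico 1 n, (logDiscount q - logDiscount (q + 1)) * W (q / n)
        - ∫ t in Ioc (0 : ℝ) 1, (Ioi (2 / (n : ℝ))).indicator
          (fun t => W t / t / (Real.log n + Real.log t) ^ 2) t)) atTop (𝓝 0) := by
    refine squeeze_zero_norm' ?_ (by simpa using herr)
    filter_upwards [eventually_ge_atTop 2] with n hn
    rw [norm_mul, norm_pow, Real.norm_of_nonneg (Real.log_natCast_nonneg n),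
      ← integral_rescale hW1 hn]
    exact mul_le_mul_of_nonneg_left (abs_discounted_sum_sub_integral_le hW (by omega))
      (pow_nonneg (Real.log_natCast_nonneg n) _)
  have := hdiff.add hmain
  rw [zero_add] at this
  refine this.congr fun n => ?_
  ring

end Ranking

/-! ### DCG as a sum over initial segments of the ranking -/

namespace Ranking

variable {𝒳 : Type*}

/-- The number of relevant objects among the `q` objects of `S` ranked highest by `f`. -/
noncomputable def topRelevant (f : 𝒳 → ℝ) {n : ℕ} (S : Dataset 𝒳 n) (q : ℕ) : ℝ :=
  ∑ r : Fin n, if r.val < q then rankedLabel f S r else 0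

lemma rankedLabel_nonneg (f : 𝒳 → ℝ) {n : ℕ} (S : Dataset 𝒳 n) (r : Fin n) :
    0 ≤ rankedLabel f S r := Nat.cast_nonneg _

lemma rankedLabel_le_one (f : 𝒳 → ℝ) {n : ℕ} (S : Dataset 𝒳 n) (r : Fin n) :
    rankedLabel f S r ≤ 1 := by
  have := (S (rankPerm f S r)).2.isLt
  exact Nat.cast_le_one.2 (Nat.lt_succ_iff.1 this)

/-- Summation by parts: the DCG is a nonnegative combination of the numbers of relevant objects in
the initial segments of the ranking, up to a term which does not depend on the ranking. -/
lemma DCG_eq_sum_topRelevant (D : ℕ → ℝ) (f : 𝒳 → ℝ) {n : ℕ} (S : Dataset 𝒳 n) :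
    DCG D f n S = ∑ q ∈ Finset.Ico 1 n, (D q - D (q + 1)) * topRelevant f S q
      + D n * ∑ i, ((S i).2.val : ℝ) := by
  have hD : ∀ r : Fin n, D (r.val + 1)
      = ∑ q ∈ Finset.Ico 1 n, (if r.val < q then D q - D (q + 1) else 0) + D n := by
    intro r
    have hf : (Finset.Ico 1 n).filter (fun q => r.val < q) = Finset.Ico (r.val + 1) n := by
      ext q
      simp only [Finset.mem_filter, Finset.mem_Ico]
      omega
    have := Finset.sum_Ico_sub (fun q => -D q) (Nat.succ_le_of_lt r.isLt)
    simp only [sub_neg_eq_add, neg_add_eq_sub] at this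
    rw [← Finset.sum_filter, hf, this]
    simp
  have hR : ∑ i, ((S i).2.val : ℝ) = ∑ r, rankedLabel f S r :=
    (Equiv.sum_comp (rankPerm f S) fun i => ((S i).2.val : ℝ)).symm
  unfold DCG topRelevant
  rw [hR, Finset.mul_sum]
  simp_rw [Finset.mul_sum]
  rw [Finset.sum_comm, ← Finset.sum_add_distrib]
  refine Finset.sum_congr rfl fun r _ => ?_
  rw [hD r, mul_add, Finset.mul_sum, mul_comm (D n)]
  congr 1
  refine Finset.sum_congr rfl fun q _ => ?_
  split_ifs <;> ring

lemma DCG_sub_DCG (D : ℕ → ℝ) (f g : 𝒳 → ℝ) {n : ℕ} (S : Dataset 𝒳 n) :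
    DCG D f n S - DCG D g n S = ∑ q ∈ Finset.Ico 1 n,
      (D q - D (q + 1)) * (topRelevant f S q - topRelevant g S q) := by
  rw [DCG_eq_sum_topRelevant, DCG_eq_sum_topRelevant, add_sub_add_right_eq_sub,
    ← Finset.sum_sub_distrib]
  exact Finset.sum_congr rfl fun q _ => by ring

/-- The number of terms of `S` which lie in `E`. -/
noncomputable def count {n : ℕ} (E : Set (𝒳 × Fin 2)) (S : Dataset 𝒳 n) : ℝ :=
  ∑ i, E.indicator 1 (S i)

/-- Both the `q` objects ranked highest and the objects in a set `E` that is upward closed for the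
score are initial segments of the ranking. Hence one of them contains the other, and the numbers of
relevant objects in them differ by no more than their sizes. -/
lemma abs_topRelevant_sub_count_le (f : 𝒳 → ℝ) {E : Set 𝒳}
    (hE : ∀ x y, f x ≤ f y → x ∈ E → y ∈ E) {n : ℕ} (S : Dataset 𝒳 n) {q : ℕ} (hq : q ≤ n) :
    |topRelevant f S q - count {z | z.2 = 1 ∧ z.1 ∈ E} S| ≤ |q - count {z | z.1 ∈ E} S| := by
  classical
  set σ := rankPerm f S with hσ
  -- Indicators, by position, of the top `q` and of the objects in `E`.
  set c : Fin n → ℝ := fun r => if r.val < q then 1 else 0 with hc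
  set s : Fin n → ℝ := fun r => if (S (σ r)).1 ∈ E then 1 else 0 with hs
  have hcq : ∑ r, c r = q := by
    rw [hc, Fin.sum_univ_eq_sum_range (fun k : ℕ => if k < q then (1 : ℝ) else 0), ← Finset.sum_filter]
    have : (Finset.range n).filter (· < q) = Finset.range q := by
      ext k
      simp only [Finset.mem_filter, Finset.mem_range]
      omega
    rw [this]
    simp
  have hsN : count {z | z.1 ∈ E} S = ∑ r, s r := by
    unfold count
    rw [← Equiv.sum_comp σ]
    refine Finset.sum_congr rfl fun r _ => ?_
    simp [hs, indicator_apply]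
  have hsR : count {z | z.2 = 1 ∧ z.1 ∈ E} S = ∑ r, s r * rankedLabel f S r := by
    unfold count
    rw [← Equiv.sum_comp σ]
    refine Finset.sum_congr rfl fun r _ => ?_
    simp only [hs, indicator_apply, rankedLabel, mem_ofPred_eq, Pi.one_apply, ← hσ]
    generalize (S (σ r)).2 = b
    fin_cases b <;> simp
  have hcR : topRelevant f S q = ∑ r, c r * rankedLabel f S r := by
    unfold topRelevant
    refine Finset.sum_congr rfl fun r _ => ?_
    simp only [hc]
    split_ifs <;> simp
  have hanti : ∀ r r' : Fin n, r ≤ r' → (S (σ r')).1 ∈ E → (S (σ r)).1 ∈ E := by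
    intro r r' h
    refine hE _ _ ?_
    have := Tuple.monotone_sort (fun i => -f (S i).1) h
    exact neg_le_neg_iff.1 this
  have hcs : (∀ r, s r ≤ c r) ∨ ∀ r, c r ≤ s r := by
    by_contra! hcon
    obtain ⟨⟨a, ha⟩, ⟨b, hb⟩⟩ := hcon
    simp only [hc, hs] at ha hb
    split_ifs at ha hb <;> try linarith
    rename_i hqa haE hbE hbq
    exact hbE (hanti b a (Fin.le_def.2 (by omega)) haE)
  rw [hsN, hsR, hcR, ← hcq, ← Finset.sum_sub_distrib, ← Finset.sum_sub_distrib]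
  simp_rw [← sub_mul]
  rcases hcs with h | h
  · have h0 : ∀ r, 0 ≤ c r - s r := fun r => sub_nonneg.2 (h r)
    rw [abs_of_nonneg (Finset.sum_nonneg fun r _ => mul_nonneg (h0 r) (rankedLabel_nonneg f S r)),
      abs_of_nonneg (Finset.sum_nonneg fun r _ => h0 r)]
    exact Finset.sum_le_sum fun r _ => mul_le_of_le_one_right (h0 r) (rankedLabel_le_one f S r)
  · have h0 : ∀ r, c r - s r ≤ 0 := fun r => sub_nonpos.2 (h r)
    rw [abs_of_nonpos (Finset.sum_nonpos fun r _ =>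
      mul_nonpos_of_nonpos_of_nonneg (h0 r) (rankedLabel_nonneg f S r)),
      abs_of_nonpos (Finset.sum_nonpos fun r _ => h0 r), neg_le_neg_iff]
    exact Finset.sum_le_sum fun r _ => by
      nlinarith [h0 r, rankedLabel_le_one f S r]

/-- If the initial segments of both rankings contain the expected numbers of relevant objects up to
an error `ε`, then the DCG's differ by the expected amount up to an error of order `ε`. -/
lemma abs_DCG_sub_DCG_sub_le {f g : 𝒳 → ℝ} {n : ℕ} (S : Dataset 𝒳 n) {u v : ℕ → ℝ} {ε : ℝ}
    (hf : ∀ q ∈ Finset.Ico 1 n, |topRelevant f S q - u q| ≤ ε)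
    (hg : ∀ q ∈ Finset.Ico 1 n, |topRelevant g S q - v q| ≤ ε) (hε : 0 ≤ ε) :
    |DCG logDiscount f n S - DCG logDiscount g n S - ∑ q ∈ Finset.Ico 1 n,
      (logDiscount q - logDiscount (q + 1)) * (u q - v q)| ≤ 2 * ε * logDiscount 1 := by
  rw [DCG_sub_DCG, ← Finset.sum_sub_distrib]
  refine (Finset.abs_sum_le_sum_abs _ _).trans ?_
  calc _ ≤ ∑ q ∈ Finset.Ico 1 n, (logDiscount q - logDiscount (q + 1)) * (2 * ε) := by
        refine Finset.sum_le_sum fun q hq => ?_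
        have h0 := sub_nonneg.2 (logDiscount_succ_le (Finset.mem_Ico.1 hq).1)
        rw [← mul_sub, abs_mul, abs_of_nonneg h0]
        refine mul_le_mul_of_nonneg_left ?_ h0
        have h1 := abs_le.1 (hf q hq)
        have h2 := abs_le.1 (hg q hq)
        rw [abs_le]
        constructor <;> linarith
    _ ≤ logDiscount 1 * (2 * ε) := by
        rw [← Finset.sum_mul]
        exact mul_le_mul_of_nonneg_right (sum_logDiscount_sub_le n) (by positivity)
    _ = _ := by ring

lemma DCG_nonneg (f : 𝒳 → ℝ) {n : ℕ} (S : Dataset 𝒳 n) : 0 ≤ DCG logDiscount f n S :=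
  Finset.sum_nonneg fun r _ =>
    mul_nonneg (rankedLabel_nonneg f S r) (logDiscount_pos (by omega)).le

lemma DCG_le (f : 𝒳 → ℝ) {n : ℕ} (S : Dataset 𝒳 n) :
    DCG logDiscount f n S ≤ n * logDiscount 1 := by
  unfold DCG
  calc _ ≤ ∑ _r : Fin n, logDiscount 1 := Finset.sum_le_sum fun r _ =>
        (mul_le_of_le_one_left (logDiscount_pos (by omega)).le (rankedLabel_le_one f S r)).trans
          (logDiscount_le (by omega))
    _ = _ := by simp

lemma DCG_le_IDCG (f : 𝒳 → ℝ) {n : ℕ} (S : Dataset 𝒳 n) :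
    DCG logDiscount f n S ≤ IDCG logDiscount n S :=
  le_ciSup (f := fun g : 𝒳 → ℝ => DCG logDiscount g n S)
    ⟨n * logDiscount 1, by rintro _ ⟨g, rfl⟩; exact DCG_le g S⟩ f

lemma IDCG_le {n : ℕ} (S : Dataset 𝒳 n) : IDCG logDiscount n S ≤ n * logDiscount 1 :=
  ciSup_le fun g => DCG_le g S

lemma NDCG_nonneg (f : 𝒳 → ℝ) {n : ℕ} (S : Dataset 𝒳 n) : 0 ≤ NDCG logDiscount f n S :=
  div_nonneg (DCG_nonneg f S) ((DCG_nonneg f S).trans (DCG_le_IDCG f S))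

lemma NDCG_le_one (f : 𝒳 → ℝ) {n : ℕ} (S : Dataset 𝒳 n) : NDCG logDiscount f n S ≤ 1 :=
  div_le_one_of_le₀ (DCG_le_IDCG f S) ((DCG_nonneg f S).trans (DCG_le_IDCG f S))

/-- As the ideal DCG is at most `n / log 2`, a gap between DCG's gives a gap between NDCG's. -/
lemma le_NDCG_sub_NDCG {f g : 𝒳 → ℝ} {n : ℕ} {S : Dataset 𝒳 n} {δ : ℝ} (hδ : 0 < δ)
    (h : n * δ ≤ DCG logDiscount f n S - DCG logDiscount g n S) (hn : 1 ≤ n) :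
    δ / logDiscount 1 ≤ NDCG logDiscount f n S - NDCG logDiscount g n S := by
  have hn0 : (0 : ℝ) < n := by exact_mod_cast hn
  have hD := logDiscount_pos le_rfl
  have hI : 0 < IDCG logDiscount n S := by
    have := DCG_le_IDCG f S
    have := DCG_nonneg g S
    have : 0 < n * δ := by positivity
    linarith
  unfold NDCG
  rw [← sub_div]
  calc δ / logDiscount 1 = n * δ / (n * logDiscount 1) := by field_simp
    _ ≤ n * δ / IDCG logDiscount n S := by
        gcongr
        exact IDCG_le S
    _ ≤ _ := by gcongr

/-- The DCG of a list of labels ranked by the permutation `σ`. -/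
noncomputable def permDCG (D : ℕ → ℝ) {n : ℕ} (σ : Equiv.Perm (Fin n)) (S : Dataset 𝒳 n) : ℝ :=
  ∑ r : Fin n, ((S (σ r)).2.val : ℝ) * D (r.val + 1)

/-- If the objects of `S` are distinct, every permutation is the ranking of some score. -/
lemma exists_rankPerm_eq {n : ℕ} {S : Dataset 𝒳 n} (hS : Function.Injective fun i => (S i).1)
    (σ : Equiv.Perm (Fin n)) : ∃ g : 𝒳 → ℝ, rankPerm g S = σ := by
  refine ⟨Function.extend (fun i => (S i).1) (fun i => -((σ.symm i).val : ℝ)) 0, ?_⟩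
  have : (fun i => -Function.extend (fun i => (S i).1) (fun i => -((σ.symm i).val : ℝ)) 0 (S i).1)
      = fun i => ((σ.symm i).val : ℝ) := by
    ext i
    rw [hS.extend_apply (fun i => -((σ.symm i).val : ℝ)) 0 i, neg_neg]
  rw [rankPerm, this, eq_comm, Tuple.eq_sort_iff]
  constructor
  · intro i j hij
    simpa using hij
  · intro i j hij h
    simp only [Equiv.symm_apply_apply, Nat.cast_inj] at h
    exact absurd (Fin.ext h) hij.ne

/-- For distinct objects the ideal DCG is a finite maximum over permutations, hence a measurable
function of the data. -/
lemma IDCG_eq_of_injective (D : ℕ → ℝ) {n : ℕ} {S : Dataset 𝒳 n}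
    (hS : Function.Injective fun i => (S i).1) :
    IDCG D n S = ⨆ σ : Equiv.Perm (Fin n), permDCG D σ S := by
  unfold IDCG iSup
  congr 1
  ext t
  constructor
  · rintro ⟨g, rfl⟩
    exact ⟨rankPerm g S, rfl⟩
  · rintro ⟨σ, rfl⟩
    obtain ⟨g, hg⟩ := exists_rankPerm_eq hS σ
    refine ⟨g, ?_⟩
    simp only [DCG, permDCG, rankedLabel, hg]

section Measurability

variable [MeasurableSpace 𝒳]

lemma measurableSet_rankPerm_eq {f : 𝒳 → ℝ} (hf : Measurable f) {n : ℕ}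
    (σ : Equiv.Perm (Fin n)) : MeasurableSet {S : Dataset 𝒳 n | rankPerm f S = σ} := by
  have hfi : ∀ i : Fin n, Measurable fun S : Dataset 𝒳 n => -f (S i).1 := fun i =>
    (hf.comp (measurable_fst.comp (measurable_pi_apply i))).neg
  have : {S : Dataset 𝒳 n | rankPerm f S = σ} =
      {S | (∀ i j : Fin n, i ≤ j → -f (S (σ i)).1 ≤ -f (S (σ j)).1) ∧
        ∀ i j : Fin n, i < j → -f (S (σ i)).1 = -f (S (σ j)).1 → σ i < σ j} := by
    ext S
    simp only [mem_ofPred_eq, rankPerm]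
    rw [eq_comm, Tuple.eq_sort_iff]
    rfl
  rw [this]
  refine MeasurableSet.inter ?_ ?_
  · refine measurableSet_setOfPred.2 ?_
    refine Measurable.forall fun i => Measurable.forall fun j => Measurable.imp measurable_const ?_
    exact measurableSet_setOfPred.1 (measurableSet_le (hfi _) (hfi _))
  · refine measurableSet_setOfPred.2 ?_
    refine Measurable.forall fun i => Measurable.forall fun j => Measurable.imp measurable_const ?_
    exact Measurable.imp (measurableSet_setOfPred.1 (measurableSet_eq_fun (hfi _) (hfi _)))
      measurable_const

lemma measurable_label {n : ℕ} (i : Fin n) :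
    Measurable fun S : Dataset 𝒳 n => ((S i).2.val : ℝ) :=
  (measurable_of_countable fun b : Fin 2 => (b.val : ℝ)).comp
    (measurable_snd.comp (measurable_pi_apply i))

lemma measurable_permDCG (D : ℕ → ℝ) {n : ℕ} (σ : Equiv.Perm (Fin n)) :
    Measurable (permDCG (𝒳 := 𝒳) D σ) :=
  Finset.measurable_fun_sum _ fun _ _ => (measurable_label _).mul_const _

/-- The ranking permutation is a measurable function of the data with finitely many values. -/
lemma measurable_DCG (D : ℕ → ℝ) {f : 𝒳 → ℝ} (hf : Measurable f) (n : ℕ) :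
    Measurable (DCG D f n) := by
  classical
  have : DCG D f n = fun S => ∑ σ : Equiv.Perm (Fin n),
      {S : Dataset 𝒳 n | rankPerm f S = σ}.indicator (permDCG D σ) S := by
    ext S
    rw [Finset.sum_eq_single (rankPerm f S)]
    · rw [indicator_of_mem (by exact rfl)]
      rfl
    · intro σ _ hσ
      exact indicator_of_notMem (s := {S : Dataset 𝒳 n | rankPerm f S = σ})
        (fun h => hσ (Eq.symm h)) _
    · simp
  rw [this]
  exact Finset.measurable_fun_sum _ fun σ _ =>
    (measurable_permDCG D σ).indicator (measurableSet_rankPerm_eq hf σ)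

end Measurability

end Ranking

/-! ### The canonical score and concentration of counts -/

namespace Ranking

lemma continuous_cdf (μ : Measure ℝ) [IsProbabilityMeasure μ] [NullSingletonClass μ] :
    Continuous (cdf μ) := by
  refine continuous_iff_continuousAt.2 fun x => ?_
  rw [(monotone_cdf μ).continuousAt_iff_leftLim_eq_rightLim, (cdf μ).rightLim_eq]
  have h := (cdf μ).measure_singleton x
  rw [measure_cdf, measure_singleton] at h
  have h1 := ENNReal.ofReal_eq_zero.1 h.symm
  have h2 := (monotone_cdf μ).leftLim_le (le_refl x)
  linarith

/-- The probability integral transform: if `μ` has no atoms, its cumulative distribution function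
maps it to the uniform distribution on `[0, 1]`. -/
lemma map_cdf_eq (μ : Measure ℝ) [IsProbabilityMeasure μ] [NullSingletonClass μ] :
    μ.map (cdf μ) = volume.restrict (Icc 0 1) := by
  have hm : Measurable (cdf μ) := (monotone_cdf μ).measurable
  have : IsProbabilityMeasure (μ.map (cdf μ)) :=
    Measure.isProbabilityMeasure_map hm.aemeasurable
  -- Every level in `(0, 1)` is attained, which gives `μ {F < s} ≤ s ≤ μ {F ≤ s}`.
  have hivt : ∀ s ∈ Ioo (0 : ℝ) 1, ∃ c, cdf μ c = s := fun s hs =>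
    mem_range_of_exists_le_of_exists_ge (continuous_cdf μ)
      ((tendsto_cdf_atBot μ).eventually_le_const hs.1).exists
      ((tendsto_cdf_atTop μ).eventually_const_le hs.2).exists
  have hge : ∀ s ∈ Ioo (0 : ℝ) 1, s ≤ μ.real {c | cdf μ c ≤ s} := by
    intro s hs
    obtain ⟨c, hc⟩ := hivt s hs
    have h := cdf_eq_real μ c
    rw [hc] at h
    rw [h]
    refine measureReal_mono fun d hd => ?_
    have := monotone_cdf μ (show d ≤ c from hd)
    rwa [cdf_eq_real μ c] at this
  have hlt : ∀ s ∈ Ioo (0 : ℝ) 1, μ.real {c | cdf μ c < s} ≤ s := by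
    intro s hs
    obtain ⟨c, hc⟩ := hivt s hs
    calc μ.real {c | cdf μ c < s} ≤ μ.real (Iic c) := by
          refine measureReal_mono fun d hd => ?_
          have hd' : cdf μ d < cdf μ c := by rw [hc]; exact hd
          exact ((monotone_cdf μ).reflect_lt hd').le
      _ = s := by rw [← cdf_eq_real, hc]
  have hle : ∀ s, 0 ≤ s → s < 1 → μ.real {c | cdf μ c ≤ s} ≤ s := by
    intro s hs0 hs1
    refine le_of_forall_gt_imp_ge_of_dense fun a ha => ?_
    obtain ⟨b, hb1, hb2⟩ := exists_between (lt_min ha hs1)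
    calc μ.real {c | cdf μ c ≤ s} ≤ μ.real {c | cdf μ c < b} :=
          measureReal_mono fun d (hd : cdf μ d ≤ s) => hd.trans_lt hb1
      _ ≤ b := hlt b ⟨hs0.trans_lt hb1, hb2.trans_le (min_le_right _ _)⟩
      _ ≤ a := hb2.le.trans (min_le_left _ _)
  refine Measure.ext_of_Iic _ _ fun s => ?_
  rw [Measure.map_apply hm measurableSet_Iic, Measure.restrict_apply measurableSet_Iic]
  have hpre : cdf μ ⁻¹' Iic s = {c | cdf μ c ≤ s} := rfl
  rw [hpre, ← ofReal_measureReal]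
  rcases lt_or_ge s 0 with hs | hs
  · have h1 : {c | cdf μ c ≤ s} = ∅ :=
      eq_empty_of_forall_notMem fun c (hc : cdf μ c ≤ s) => by linarith [cdf_nonneg μ c]
    have h2 : Iic s ∩ Icc 0 1 = (∅ : Set ℝ) :=
      eq_empty_of_forall_notMem fun c hc => by linarith [hc.2.1, mem_Iic.1 hc.1]
    rw [h1, h2]
    simp
  · rcases lt_or_ge s 1 with hs1 | hs1
    · have h2 : Iic s ∩ Icc 0 1 = Icc 0 s := by
        ext c
        simp only [mem_inter_iff, mem_Iic, mem_Icc]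
        constructor
        · rintro ⟨h, h', _⟩; exact ⟨h', h⟩
        · rintro ⟨h, h'⟩; exact ⟨h', h, h'.trans hs1.le⟩
      rw [h2, Real.volume_Icc, sub_zero]
      congr 1
      refine le_antisymm (hle s hs hs1) ?_
      rcases hs.eq_or_lt with h0 | h0
      · rw [← h0]; exact measureReal_nonneg
      · exact hge s ⟨h0, hs1⟩
    · have h1 : {c | cdf μ c ≤ s} = univ :=
        eq_univ_of_forall fun c => (cdf_le_one μ c).trans hs1
      have h2 : Iic s ∩ Icc 0 1 = Icc (0 : ℝ) 1 :=
        inter_eq_right.2 fun c hc => hc.2.trans hs1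
      rw [h1, h2]
      simp

variable {𝒳 : Type*} [MeasurableSpace 𝒳] {P : Measure (𝒳 × Fin 2)}

lemma measurableSet_relevant : MeasurableSet {z : 𝒳 × Fin 2 | z.2 = 1} :=
  measurable_snd (measurableSet_singleton 1)

/-- The probability that an object is relevant and belongs to the fraction `t` of the objects which
`f` ranks highest. -/
noncomputable def topMass (P : Measure (𝒳 × Fin 2)) (f : 𝒳 → ℝ) (t : ℝ) : ℝ :=
  P.real {z | z.2 = 1 ∧ z.1 ∈ {x | 1 - t ≤ canonical P f x}}

lemma topMass_of_one_le (f : 𝒳 → ℝ) {t : ℝ} (h : 1 ≤ t) :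
    topMass P f t = P.real {z | z.2 = 1} := by
  unfold topMass
  congr 1
  ext z
  refine ⟨fun hz => hz.1, fun hz => ⟨hz, ?_⟩⟩
  have : 0 ≤ canonical P f z.1 := measureReal_nonneg
  show 1 - t ≤ canonical P f z.1
  linarith

variable [IsProbabilityMeasure P]

lemma canonical_eq_cdf {f : 𝒳 → ℝ} (hf : Measurable f) (x : 𝒳) :
    canonical P f x = cdf (P.map fun z => f z.1) (f x) := by
  have hf' : Measurable fun z : 𝒳 × Fin 2 => f z.1 := hf.comp measurable_fst
  have := Measure.isProbabilityMeasure_map hf'.aemeasurable (μ := P)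
  rw [cdf_eq_real, map_measureReal_apply hf' measurableSet_Iic]
  rfl

lemma measurable_canonical {f : 𝒳 → ℝ} (hf : Measurable f) : Measurable (canonical P f) := by
  have h : canonical P f = fun x => cdf (P.map fun z => f z.1) (f x) :=
    funext fun x => canonical_eq_cdf hf x
  rw [h]
  exact (monotone_cdf _).measurable.comp hf

lemma canonical_mono (f : 𝒳 → ℝ) {x y : 𝒳} (h : f x ≤ f y) :
    canonical P f x ≤ canonical P f y :=
  measureReal_mono fun z (hz : f z.1 ≤ f x) => hz.trans h

lemma map_canonical {f : 𝒳 → ℝ} (hf : Measurable f) (ht : ∀ t, P {z | f z.1 = t} = 0) :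
    P.map (fun z => canonical P f z.1) = volume.restrict (Icc 0 1) := by
  have hf' : Measurable fun z : 𝒳 × Fin 2 => f z.1 := hf.comp measurable_fst
  have := Measure.isProbabilityMeasure_map hf'.aemeasurable (μ := P)
  have : NullSingletonClass (P.map fun z => f z.1) := ⟨fun t => by
    rw [Measure.map_apply hf' (measurableSet_singleton t)]; exact ht t⟩
  rw [← map_cdf_eq (P.map fun z => f z.1),
    Measure.map_map (monotone_cdf _).measurable hf']
  exact congrArg (fun g => P.map g) (funext fun z => canonical_eq_cdf hf z.1)

lemma measurableSet_top {f : 𝒳 → ℝ} (hf : Measurable f) (t : ℝ) :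
    MeasurableSet {z : 𝒳 × Fin 2 | z.1 ∈ {x | t ≤ canonical P f x}} :=
  measurableSet_le measurable_const ((measurable_canonical hf).comp measurable_fst)

lemma measure_canonical_mem {f : 𝒳 → ℝ} (hf : Measurable f) (ht : ∀ t, P {z | f z.1 = t} = 0)
    {A : Set ℝ} (hA : MeasurableSet A) :
    P {z | canonical P f z.1 ∈ A} = volume (A ∩ Icc 0 1) := by
  have hm : Measurable fun z : 𝒳 × Fin 2 => canonical P f z.1 :=
    (measurable_canonical hf).comp measurable_fst
  rw [← Measure.restrict_apply hA, ← map_canonical hf ht, Measure.map_apply hm hA]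
  rfl

lemma measureReal_top {f : 𝒳 → ℝ} (hf : Measurable f) (ht : ∀ t, P {z | f z.1 = t} = 0)
    {t : ℝ} (h : t ∈ Icc (0 : ℝ) 1) :
    P.real {z | z.1 ∈ {x | 1 - t ≤ canonical P f x}} = t := by
  have h1 := measure_canonical_mem hf ht (measurableSet_Ici (a := 1 - t))
  have h2 : Ici (1 - t) ∩ Icc 0 1 = Icc (1 - t) 1 := by
    ext c
    simp only [mem_inter_iff, mem_Ici, mem_Icc]
    constructor
    · rintro ⟨h, _, h'⟩; exact ⟨h, h'⟩
    · rintro ⟨h', h''⟩; exact ⟨h', by linarith [h.2], h''⟩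
  rw [h2, Real.volume_Icc, sub_sub_cancel] at h1
  have h3 : P.real {z | canonical P f z.1 ∈ Ici (1 - t)} = t := by
    rw [measureReal_def, h1, ENNReal.toReal_ofReal h.1]
  exact h3

lemma topMass_mono (f : 𝒳 → ℝ) : Monotone (topMass P f) := by
  intro s t hst
  refine measureReal_mono fun z hz => ⟨hz.1, ?_⟩
  have h : 1 - s ≤ canonical P f z.1 := hz.2
  show 1 - t ≤ canonical P f z.1
  linarith

lemma topMass_sub_le {f : 𝒳 → ℝ} (hf : Measurable f) (ht : ∀ t, P {z | f z.1 = t} = 0)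
    {s t : ℝ} (hst : s ≤ t) : topMass P f t - topMass P f s ≤ t - s := by
  have h1 : topMass P f t ≤ topMass P f s
      + P.real {z | canonical P f z.1 ∈ Ico (1 - t) (1 - s)} := by
    refine (measureReal_mono fun z hz => ?_).trans (measureReal_union_le _ _)
    by_cases h : 1 - s ≤ canonical P f z.1
    · exact Or.inl ⟨hz.1, h⟩
    · exact Or.inr ⟨hz.2, not_le.1 h⟩
  have h2 : P.real {z | canonical P f z.1 ∈ Ico (1 - t) (1 - s)} ≤ t - s := by
    rw [measureReal_def, measure_canonical_mem hf ht measurableSet_Ico]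
    refine ENNReal.toReal_le_of_le_ofReal (by linarith) ?_
    calc volume (Ico (1 - t) (1 - s) ∩ Icc 0 1) ≤ volume (Ico (1 - t) (1 - s)) :=
          measure_mono inter_subset_left
      _ = _ := by rw [Real.volume_Ico]; congr 1; ring
  linarith

lemma topMass_zero {f : 𝒳 → ℝ} (hf : Measurable f) (ht : ∀ t, P {z | f z.1 = t} = 0) :
    topMass P f 0 = 0 := by
  refine le_antisymm ?_ measureReal_nonneg
  calc topMass P f 0 ≤ P.real {z | z.1 ∈ {x | 1 - 0 ≤ canonical P f x}} :=
        measureReal_mono fun z hz => hz.2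
    _ = 0 := measureReal_top hf ht ⟨le_rfl, zero_le_one⟩

lemma lipschitzWith_topMass_sub {f g : 𝒳 → ℝ} (hf : Measurable f)
    (htf : ∀ t, P {z | f z.1 = t} = 0) (hg : Measurable g)
    (htg : ∀ t, P {z | g z.1 = t} = 0) :
    LipschitzWith 1 fun t => topMass P f t - topMass P g t := by
  have key : ∀ s t, s ≤ t →
      |(topMass P f s - topMass P g s) - (topMass P f t - topMass P g t)| ≤ |s - t| := by
    intro s t hst
    have h1 := topMass_sub_le hf htf hst
    have h2 := topMass_sub_le hg htg hst
    have h3 := topMass_mono (P := P) f hst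
    have h4 := topMass_mono (P := P) g hst
    rw [abs_sub_comm s t, abs_of_nonneg (sub_nonneg.2 hst), abs_le]
    constructor <;> linarith
  refine LipschitzWith.of_dist_le_mul fun s t => ?_
  rw [NNReal.coe_one, one_mul, Real.dist_eq, Real.dist_eq]
  rcases le_total s t with h | h
  · exact key s t h
  · rw [abs_sub_comm, abs_sub_comm s t]
    exact key t s h

/-- The relevance curve is determined by the function `topMass`. -/
lemma relevanceCurve_ae_eq {f g : 𝒳 → ℝ} (hf : Measurable f)
    (htf : ∀ t, P {z | f z.1 = t} = 0) (hg : Measurable g)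
    (htg : ∀ t, P {z | g z.1 = t} = 0) {u v : ℝ → ℝ} (hu : IsRelevanceCurve P f u)
    (hv : IsRelevanceCurve P g v) (h : ∀ t ∈ Icc (0 : ℝ) 1, topMass P f t = topMass P g t) :
    ∀ᵐ s ∂(volume.restrict (Icc (0 : ℝ) 1)), u s = v s := by
  have hall : ∀ t, topMass P f t = topMass P g t := by
    intro t
    rcases lt_or_ge t 0 with h0 | h0
    · have h1 := topMass_mono (P := P) f h0.le
      have h2 := topMass_mono (P := P) g h0.le
      rw [topMass_zero hf htf] at h1
      rw [topMass_zero hg htg] at h2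
      have h3 : 0 ≤ topMass P f t := measureReal_nonneg
      have h4 : 0 ≤ topMass P g t := measureReal_nonneg
      linarith
    · rcases le_total t 1 with h1 | h1
      · exact h t ⟨h0, h1⟩
      · rw [topMass_of_one_le f h1, topMass_of_one_le g h1]
  have hmf : Measurable fun z : 𝒳 × Fin 2 => canonical P f z.1 :=
    (measurable_canonical hf).comp measurable_fst
  have hmg : Measurable fun z : 𝒳 × Fin 2 => canonical P g z.1 :=
    (measurable_canonical hg).comp measurable_fst
  have happ : ∀ {k : 𝒳 → ℝ}, Measurable k → ∀ {A : Set ℝ}, MeasurableSet A →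
      ((P.restrict {z | z.2 = 1}).map fun z => canonical P k z.1) A
        = P {z | z.2 = 1 ∧ canonical P k z.1 ∈ A} := by
    intro k hk A hA
    have hmk : Measurable fun z : 𝒳 × Fin 2 => canonical P k z.1 :=
      (measurable_canonical hk).comp measurable_fst
    rw [Measure.map_apply hmk hA, Measure.restrict_apply (hmk hA), inter_comm]
    rfl
  have hmeas : (P.restrict {z | z.2 = 1}).map (fun z => canonical P f z.1)
      = (P.restrict {z | z.2 = 1}).map fun z => canonical P g z.1 := by
    refine Measure.ext_of_Ici _ _ fun a => ?_
    rw [happ hf measurableSet_Ici, happ hg measurableSet_Ici]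
    have := hall (1 - a)
    simp only [topMass, sub_sub_cancel] at this
    exact (measureReal_eq_measureReal_iff).1 this
  obtain ⟨hu1, hu2⟩ := hu
  obtain ⟨hv1, hv2⟩ := hv
  rw [map_canonical hf htf] at hu1 hu2
  rw [map_canonical hg htg] at hv1 hv2
  refine Integrable.ae_eq_of_forall_setIntegral_eq u v hu1 hv1 fun A hA _ => ?_
  rw [← hu2 A hA, ← hv2 A hA, measureReal_def, measureReal_def, ← happ hf hA, ← happ hg hA, hmeas]

/-- Hoeffding's inequality for the number of sample points in a measurable set. -/
lemma measure_count_le {E : Set (𝒳 × Fin 2)} (hE : MeasurableSet E) (n : ℕ) {ε : ℝ}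
    (hε : 0 ≤ ε) :
    (Measure.pi fun _ : Fin n => P).real {S | ε ≤ count E S - n * P.real E}
      ≤ Real.exp (-2 * ε ^ 2 / n) := by
  set X : Fin n → Dataset 𝒳 n → ℝ := fun i S => E.indicator 1 (S i) - P.real E with hX
  have hm : Measurable (E.indicator (1 : 𝒳 × Fin 2 → ℝ)) := measurable_one.indicator hE
  have hind : iIndepFun X (Measure.pi fun _ : Fin n => P) :=
    iIndepFun_pi (X := fun _ : Fin n => fun z => E.indicator (1 : 𝒳 × Fin 2 → ℝ) z - P.real E)
      fun _ => (hm.sub_const _).aemeasurable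
  have hsub : ∀ i ∈ Finset.univ, HasSubgaussianMGF (X i) ((‖(1 : ℝ) - 0‖₊ / 2) ^ 2)
      (Measure.pi fun _ : Fin n => P) := by
    intro i _
    have hint : ∫ S : Dataset 𝒳 n, E.indicator (1 : 𝒳 × Fin 2 → ℝ) (S i)
        ∂(Measure.pi fun _ : Fin n => P) = P.real E := by
      have h := integral_map (μ := Measure.pi fun _ : Fin n => P)
        (measurable_pi_apply i).aemeasurable (f := E.indicator (1 : 𝒳 × Fin 2 → ℝ))
        hm.aestronglyMeasurable
      have h' : (Measure.pi fun _ : Fin n => P).map (fun S : Dataset 𝒳 n => S i) = P :=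
        (measurePreserving_eval (fun _ : Fin n => P) i).map_eq
      rw [← h, h', integral_indicator_one hE]
    have := hasSubgaussianMGF_of_mem_Icc (μ := Measure.pi fun _ : Fin n => P)
      (X := fun S : Dataset 𝒳 n => E.indicator (1 : 𝒳 × Fin 2 → ℝ) (S i)) (a := 0) (b := 1)
      (hm.comp (measurable_pi_apply i)).aemeasurable (Eventually.of_forall fun S => by
        by_cases h : S i ∈ E <;> simp [h])
    rwa [hint] at this
  have h := HasSubgaussianMGF.measure_sum_ge_le_of_iIndepFun hind hsub hε
  have h1 : ∀ S, ∑ i, X i S = count E S - n * P.real E := by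
    intro S
    simp [hX, count, Finset.sum_sub_distrib]
  simp_rw [h1] at h
  refine h.trans (le_of_eq ?_)
  congr 1
  simp
  rcases Nat.eq_zero_or_pos n with rfl | hn
  · simp
  · have : (n : ℝ) ≠ 0 := by positivity
    field_simp

lemma measure_abs_count_le {E : Set (𝒳 × Fin 2)} (hE : MeasurableSet E) (n : ℕ) {ε : ℝ}
    (hε : 0 ≤ ε) :
    (Measure.pi fun _ : Fin n => P).real {S | ε ≤ |count E S - n * P.real E|}
      ≤ 2 * Real.exp (-2 * ε ^ 2 / n) := by
  have hc : ∀ S : Dataset 𝒳 n, count Eᶜ S = n - count E S := by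
    intro S
    unfold count
    rw [eq_sub_iff_add_eq, ← Finset.sum_add_distrib]
    have : ∀ z : 𝒳 × Fin 2, Eᶜ.indicator (1 : 𝒳 × Fin 2 → ℝ) z + E.indicator 1 z = 1 := by
      intro z
      by_cases h : z ∈ E <;> simp [h]
    simp [this]
  have h1 := measure_count_le (P := P) hE n hε
  have h2 := measure_count_le (P := P) hE.compl n hε
  rw [probReal_compl_eq_one_sub hE] at h2
  calc (Measure.pi fun _ : Fin n => P).real {S | ε ≤ |count E S - n * P.real E|}
      ≤ (Measure.pi fun _ : Fin n => P).real ({S | ε ≤ count E S - n * P.real E} ∪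
        {S | ε ≤ count Eᶜ S - n * (1 - P.real E)}) := by
        refine measureReal_mono fun S hS => ?_
        rcases le_abs.1 (show ε ≤ |count E S - n * P.real E| from hS) with h | h
        · exact Or.inl h
        · right
          show ε ≤ count Eᶜ S - n * (1 - P.real E)
          rw [hc]
          linarith
    _ ≤ _ := measureReal_union_le _ _
    _ ≤ _ := by linarith

/-- Uniformly in `q`, the number of relevant objects among the top `q` is close to its expected
value `n * topMass P f (q / n)`, with overwhelming probability. -/
lemma measure_topRelevant_le {f : 𝒳 → ℝ} (hf : Measurable f) (ht : ∀ t, P {z | f z.1 = t} = 0)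
    (n : ℕ) {ε : ℝ} (hε : 0 ≤ ε) :
    (Measure.pi fun _ : Fin n => P).real
      {S | ∃ q ∈ Finset.Ico 1 n, 2 * ε < |topRelevant f S q - n * topMass P f (q / n)|}
      ≤ n * (4 * Real.exp (-2 * ε ^ 2 / n)) := by
  set A : ℕ → Set (Dataset 𝒳 n) := fun q =>
    {S | ε ≤ |count {z | z.2 = 1 ∧ z.1 ∈ {x | 1 - (q : ℝ) / n ≤ canonical P f x}} S
        - n * P.real {z | z.2 = 1 ∧ z.1 ∈ {x | 1 - (q : ℝ) / n ≤ canonical P f x}}|} ∪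
      {S | ε ≤ |count {z | z.1 ∈ {x | 1 - (q : ℝ) / n ≤ canonical P f x}} S
        - n * P.real {z | z.1 ∈ {x | 1 - (q : ℝ) / n ≤ canonical P f x}}|} with hA
  have hsub : {S | ∃ q ∈ Finset.Ico 1 n, 2 * ε < |topRelevant f S q - n * topMass P f (q / n)|}
      ⊆ ⋃ q ∈ Finset.Ico 1 n, A q := by
    rintro S ⟨q, hq, hlt⟩
    refine mem_iUnion₂.2 ⟨q, hq, ?_⟩
    obtain ⟨hq1, hqn⟩ := Finset.mem_Ico.1 hq
    have hn0 : (0 : ℝ) < n := by exact_mod_cast (by omega : 0 < n)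
    have hqn' : (q : ℝ) / n ∈ Icc (0 : ℝ) 1 :=
      ⟨by positivity, by rw [div_le_one hn0]; exact_mod_cast hqn.le⟩
    by_contra hcon
    simp only [hA, mem_union, not_or] at hcon
    obtain ⟨h1, h2⟩ := hcon
    have h1' := not_le.1 (mem_ofPred_eq ▸ h1)
    have h2' := not_le.1 (mem_ofPred_eq ▸ h2)
    rw [measureReal_top hf ht hqn', mul_div_cancel₀ _ hn0.ne', abs_sub_comm] at h2'
    have h3 := abs_topRelevant_sub_count_le f
      (E := {x | 1 - (q : ℝ) / n ≤ canonical P f x})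
      (fun x y hxy (hx : _ ≤ _) => hx.trans (canonical_mono f hxy)) S hqn.le
    have h4 := abs_sub_le (topRelevant f S q)
      (count {z | z.2 = 1 ∧ z.1 ∈ {x | 1 - (q : ℝ) / n ≤ canonical P f x}} S)
      (n * topMass P f (q / n))
    have h5 : n * topMass P f (q / n) = n * P.real {z | z.2 = 1 ∧
      z.1 ∈ {x | 1 - (q : ℝ) / n ≤ canonical P f x}} := rfl
    rw [← h5] at h1'
    linarith
  refine (measureReal_mono hsub (measure_ne_top _ _)).trans
    ((measureReal_biUnion_finset_le _ _).trans ?_)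
  calc _ ≤ ∑ q ∈ Finset.Ico 1 n, 4 * Real.exp (-2 * ε ^ 2 / n) := by
        refine Finset.sum_le_sum fun q _ => (measureReal_union_le _ _).trans ?_
        have h1 := measure_abs_count_le (P := P)
          (measurableSet_relevant.inter (measurableSet_top (P := P) hf (1 - (q : ℝ) / n))) n hε
        have h2 := measure_abs_count_le (P := P) (measurableSet_top (P := P) hf (1 - (q : ℝ) / n)) n hε
        refine (add_le_add h1 h2).trans (le_of_eq ?_)
        ring
    _ ≤ _ := by
        rw [Finset.sum_const, Nat.card_Ico, nsmul_eq_mul]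
        gcongr
        exact Nat.sub_le n 1

end Ranking

/-! ### The gap between the DCG's, negligible tails, and integrability -/

namespace Ranking

variable {𝒳 : Type*} [MeasurableSpace 𝒳] {P : Measure (𝒳 × Fin 2)} [IsProbabilityMeasure P]

/-- The bound for the probability that a sample of size `n` is atypical for one of the two rankings:
there are two rankings, fewer than `n` positions, two counts for each and two tails for each count. -/
noncomputable def failureBound (n : ℕ) : ℝ := 8 * n * Real.exp (-2 * √n)

/-- Fluctuations of order `n ^ (3 / 4)` are eventually below any multiple of `n / (log n) ^ k`. -/
lemma eventually_rpow_le_div_log_pow (k : ℕ) {a b : ℝ} (hb : 0 < b) :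
    ∀ᶠ n : ℕ in atTop, a * (n : ℝ) ^ (3 / 4 : ℝ) ≤ n * (b / Real.log n ^ k) := by
  have h := ((isLittleO_log_rpow_rpow_atTop (k : ℝ) (by norm_num : (0 : ℝ) < 1 / 4)).comp_tendsto
    tendsto_natCast_atTop_atTop).bound (show 0 < b / (|a| + 1) by positivity)
  filter_upwards [h, eventually_ge_atTop 2] with n hn hn2
  have hn0 : (0 : ℝ) < n := by exact_mod_cast (by omega : 0 < n)
  have hlog : 0 < Real.log n := Real.log_pos (by exact_mod_cast (by omega : 1 < n))
  simp only [Function.comp, Real.rpow_natCast] at hn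
  rw [Real.norm_of_nonneg (by positivity), Real.norm_of_nonneg (by positivity)] at hn
  have hsplit : (n : ℝ) = (n : ℝ) ^ (3 / 4 : ℝ) * (n : ℝ) ^ (1 / 4 : ℝ) := by
    rw [← Real.rpow_add hn0]; norm_num
  rw [← mul_div_assoc, le_div_iff₀ (by positivity)]
  calc a * (n : ℝ) ^ (3 / 4 : ℝ) * Real.log n ^ k
      ≤ (|a| + 1) * (n : ℝ) ^ (3 / 4 : ℝ) * (b / (|a| + 1) * (n : ℝ) ^ (1 / 4 : ℝ)) := by
        gcongr
        linarith [le_abs_self a]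
    _ = (n : ℝ) ^ (3 / 4 : ℝ) * (n : ℝ) ^ (1 / 4 : ℝ) * b := by field_simp
    _ = n * b := by rw [← hsplit]

/-- With overwhelming probability the gap between the DCG's is of the order of its expected value,
`n / (log n) ^ k`, since the fluctuations are of order at most `n ^ (3 / 4)`. -/
lemma exists_measure_DCG_sub_lt_le {f g : 𝒳 → ℝ} (hf : Measurable f)
    (htf : ∀ t, P {z | f z.1 = t} = 0) (hg : Measurable g)
    (htg : ∀ t, P {z | g z.1 = t} = 0) {k : ℕ} {c : ℝ} (hc : 0 < c)
    (h : Tendsto (fun n : ℕ => Real.log n ^ k * ∑ q ∈ Finset.Ico 1 n,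
      (logDiscount q - logDiscount (q + 1)) * (topMass P f (q / n) - topMass P g (q / n))) atTop
      (𝓝 c)) :
    ∃ a > 0, ∀ᶠ n : ℕ in atTop, (Measure.pi fun _ : Fin n => P).real
      {S | DCG logDiscount f n S - DCG logDiscount g n S < n * (a / Real.log n ^ k)}
        ≤ failureBound n := by
  refine ⟨c / 4, by positivity, ?_⟩
  filter_upwards [h.eventually_const_le (show c / 2 < c by linarith), eventually_ge_atTop 2,
    eventually_rpow_le_div_log_pow k (a := 4 * logDiscount 1) (show 0 < c / 4 by positivity)]
    with n h1 hn2 h2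
  have hn0 : (0 : ℝ) < n := by exact_mod_cast (by omega : 0 < n)
  have hlog : 0 < Real.log n := Real.log_pos (by exact_mod_cast (by omega : 1 < n))
  -- Any exponent in `(1 / 2, 1)` makes both the deviation `ε / n` and its probability small.
  set ε : ℝ := (n : ℝ) ^ (3 / 4 : ℝ) with hε
  have hε0 : 0 ≤ ε := by positivity
  have hexp : -2 * ε ^ 2 / n = -2 * √n := by
    have h3 : ε ^ 2 = √n * n := by
      rw [hε, Real.sqrt_eq_rpow, ← Real.rpow_natCast, ← Real.rpow_mul hn0.le,
        ← Real.rpow_add_one hn0.ne']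
      norm_num
    rw [h3]
    field_simp
  have hF := measure_topRelevant_le hf htf n hε0
  have hG := measure_topRelevant_le hg htg n hε0
  rw [hexp] at hF hG
  have hsub : {S : Dataset 𝒳 n | DCG logDiscount f n S - DCG logDiscount g n S
        < n * (c / 4 / Real.log n ^ k)} ⊆
      {S | ∃ q ∈ Finset.Ico 1 n, 2 * ε < |topRelevant f S q - n * topMass P f (q / n)|} ∪
      {S | ∃ q ∈ Finset.Ico 1 n, 2 * ε < |topRelevant g S q - n * topMass P g (q / n)|} := by
    intro S hS
    by_contra hcon
    rw [mem_union, not_or] at hcon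
    have hu : ∀ q ∈ Finset.Ico 1 n, |topRelevant f S q - n * topMass P f (q / n)| ≤ 2 * ε :=
      fun q hq => not_lt.1 fun h => hcon.1 ⟨q, hq, h⟩
    have hv : ∀ q ∈ Finset.Ico 1 n, |topRelevant g S q - n * topMass P g (q / n)| ≤ 2 * ε :=
      fun q hq => not_lt.1 fun h => hcon.2 ⟨q, hq, h⟩
    have h3 := (abs_le.1 (abs_DCG_sub_DCG_sub_le S hu hv (by positivity))).1
    have h4 : ∑ q ∈ Finset.Ico 1 n, (logDiscount q - logDiscount (q + 1)) *
        (n * topMass P f (q / n) - n * topMass P g (q / n))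
        = n * ∑ q ∈ Finset.Ico 1 n, (logDiscount q - logDiscount (q + 1)) *
          (topMass P f (q / n) - topMass P g (q / n)) := by
      rw [Finset.mul_sum]
      exact Finset.sum_congr rfl fun q _ => by ring
    rw [h4] at h3
    have h5 : n * (c / 2 / Real.log n ^ k) ≤ n * ∑ q ∈ Finset.Ico 1 n,
        (logDiscount q - logDiscount (q + 1)) *
          (topMass P f (q / n) - topMass P g (q / n)) := by
      refine mul_le_mul_of_nonneg_left ?_ hn0.le
      rw [div_le_iff₀ (by positivity), mul_comm]
      exact h1
    have h6 : n * (c / 2 / Real.log n ^ k)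
        = n * (c / 4 / Real.log n ^ k) + n * (c / 4 / Real.log n ^ k) := by ring
    have h7 : DCG logDiscount f n S - DCG logDiscount g n S < n * (c / 4 / Real.log n ^ k) := hS
    linarith
  refine (measureReal_mono hsub (measure_ne_top _ _)).trans ((measureReal_union_le _ _).trans ?_)
  refine (add_le_add hF hG).trans (le_of_eq ?_)
  unfold failureBound
  ring

lemma isNegligible_failureBound : IsNegligible failureBound := by
  refine ⟨fun n => by unfold failureBound; positivity, fun c => ?_⟩
  obtain ⟨m, hm⟩ := exists_nat_ge c
  have hsqrt : Tendsto (fun n : ℕ => √(n : ℝ)) atTop atTop :=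
    Real.tendsto_sqrt_atTop.comp tendsto_natCast_atTop_atTop
  have h := ((Real.tendsto_pow_mul_exp_neg_atTop_nhds_zero (2 * (m + 1))).comp hsqrt)
  filter_upwards [h.eventually_lt_const (show (0 : ℝ) < 1 / 8 by norm_num), eventually_ge_atTop 1]
    with n hn hn1
  have hn1' : (1 : ℝ) ≤ n := by exact_mod_cast hn1
  have hn0 : (0 : ℝ) < n := by linarith
  simp only [Function.comp] at hn
  rw [pow_mul, Real.sq_sqrt hn0.le] at hn
  have hpow : (n : ℝ) ^ m ≥ (n : ℝ) ^ c := by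
    rw [← Real.rpow_natCast]
    exact Real.rpow_le_rpow_of_exponent_le hn1' hm
  rw [Real.rpow_neg hn0.le, ← one_div, lt_div_iff₀ (Real.rpow_pos_of_pos hn0 c)]
  calc failureBound n * (n : ℝ) ^ c ≤ 8 * n * Real.exp (-√n) * (n : ℝ) ^ m := by
        unfold failureBound
        gcongr
        linarith [Real.sqrt_nonneg (n : ℝ)]
    _ = 8 * ((n : ℝ) ^ (m + 1) * Real.exp (-√n)) := by ring
    _ < 1 := by linarith

lemma IsNegligible.summable {ν : ℕ → ℝ} (h : IsNegligible ν) : Summable ν := by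
  obtain ⟨N, hN⟩ := eventually_atTop.1 (h.2 2)
  refine (summable_nat_add_iff N).1 ?_
  refine Summable.of_nonneg_of_le (fun n => h.1 _) (fun n => (hN (n + N) (by omega)).le) ?_
  exact (summable_nat_add_iff (f := fun n : ℕ => (n : ℝ) ^ (-2 : ℝ)) N).2
    (Real.summable_nat_rpow.2 (by norm_num))

/-- The tails of the series of a negligible function are negligible. -/
lemma IsNegligible.tail {ν : ℕ → ℝ} (h : IsNegligible ν) :
    IsNegligible fun N => ∑' n, ν (n + N) := by
  refine ⟨fun N => tsum_nonneg fun n => h.1 _, fun c => ?_⟩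
  have hs : Summable fun n : ℕ => (n : ℝ) ^ (-2 : ℝ) := Real.summable_nat_rpow.2 (by norm_num)
  obtain ⟨N₀, hN₀⟩ := eventually_atTop.1 (h.2 (|c| + 3))
  obtain ⟨M, hM⟩ := exists_nat_gt (∑' n : ℕ, (n : ℝ) ^ (-2 : ℝ))
  filter_upwards [eventually_ge_atTop N₀, eventually_ge_atTop M, eventually_ge_atTop 1]
    with N h0 h1 h2
  have hN1 : (1 : ℝ) ≤ N := by exact_mod_cast h2
  have hNpos : (0 : ℝ) < N := by linarith
  have hterm : ∀ n : ℕ, ν (n + N) ≤ (N : ℝ) ^ (-c - 1) * ((n + N : ℕ) : ℝ) ^ (-2 : ℝ) := by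
    intro n
    have hle : (N : ℝ) ≤ ((n + N : ℕ) : ℝ) := by exact_mod_cast Nat.le_add_left N n
    have hpos : (0 : ℝ) < ((n + N : ℕ) : ℝ) := by linarith
    calc ν (n + N) ≤ ((n + N : ℕ) : ℝ) ^ (-(|c| + 3)) := (hN₀ (n + N) (by omega)).le
      _ = ((n + N : ℕ) : ℝ) ^ (-(|c| + 1)) * ((n + N : ℕ) : ℝ) ^ (-2 : ℝ) := by
          rw [← Real.rpow_add hpos]; congr 1; ring
      _ ≤ (N : ℝ) ^ (-(|c| + 1)) * ((n + N : ℕ) : ℝ) ^ (-2 : ℝ) := by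
          refine mul_le_mul_of_nonneg_right ?_ (by positivity)
          exact Real.rpow_le_rpow_of_nonpos hNpos hle (by linarith [abs_nonneg c])
      _ ≤ (N : ℝ) ^ (-c - 1) * ((n + N : ℕ) : ℝ) ^ (-2 : ℝ) := by
          refine mul_le_mul_of_nonneg_right ?_ (by positivity)
          exact Real.rpow_le_rpow_of_exponent_le hN1 (by linarith [le_abs_self c])
  have hsN : Summable fun n : ℕ => ((n + N : ℕ) : ℝ) ^ (-2 : ℝ) :=
    (summable_nat_add_iff (f := fun n : ℕ => (n : ℝ) ^ (-2 : ℝ)) N).2 hs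
  have htail : ∑' n : ℕ, ((n + N : ℕ) : ℝ) ^ (-2 : ℝ) ≤ ∑' n : ℕ, (n : ℝ) ^ (-2 : ℝ) := by
    have := hs.sum_add_tsum_nat_add N
    have h0 : 0 ≤ ∑ i ∈ Finset.range N, (i : ℝ) ^ (-2 : ℝ) :=
      Finset.sum_nonneg fun i _ => by positivity
    linarith
  calc ∑' n, ν (n + N) ≤ ∑' n : ℕ, (N : ℝ) ^ (-c - 1) * ((n + N : ℕ) : ℝ) ^ (-2 : ℝ) :=
        ((summable_nat_add_iff N).2 h.summable).tsum_le_tsum hterm (hsN.mul_left _)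
    _ = (N : ℝ) ^ (-c - 1) * ∑' n : ℕ, ((n + N : ℕ) : ℝ) ^ (-2 : ℝ) := tsum_mul_left
    _ < (N : ℝ) ^ (-c - 1) * N := by
        refine mul_lt_mul_of_pos_left ?_ (by positivity)
        exact (htail.trans_lt hM).trans_le (by exact_mod_cast h1)
    _ = (N : ℝ) ^ (-c) := by
        rw [← Real.rpow_add_one hNpos.ne']; congr 1; ring

/-- The first `n` terms of an i.i.d. sequence are `n` i.i.d. draws. -/
lemma map_firstN (n : ℕ) :
    (Measure.infinitePi fun _ : ℕ => P).map (fun z => firstN z n) = Measure.pi fun _ : Fin n => P := by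
  have hind := iIndepFun_infinitePi (P := fun _ : ℕ => P) (X := fun _ z => z)
    (fun _ => measurable_id)
  have h2 := hind.precomp (g := fun i : Fin n => (i : ℕ)) Fin.val_injective
  have h3 := (iIndepFun_iff_map_fun_eq_pi_map
    (fun i : Fin n => (measurable_pi_apply (i : ℕ)).aemeasurable)).1 h2
  refine h3.trans ?_
  congr 1
  ext1 i
  exact Measure.infinitePi_map_eval (fun _ : ℕ => P) (i : ℕ)

lemma measurable_firstN (n : ℕ) : Measurable fun z : ℕ → 𝒳 × Fin 2 => firstN z n :=
  measurable_pi_lambda _ fun i => measurable_pi_apply (i : ℕ)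

/-- Almost surely the objects of a sample are distinct, because their scores are. -/
lemma ae_injective {f : 𝒳 → ℝ} (hf : Measurable f) (ht : ∀ t, P {z | f z.1 = t} = 0) (n : ℕ) :
    ∀ᵐ S : Dataset 𝒳 n ∂(Measure.pi fun _ => P), Function.Injective fun i => (S i).1 := by
  have hne : ∀ i j : Fin n, i ≠ j →
      ∀ᵐ S : Dataset 𝒳 n ∂(Measure.pi fun _ => P), f (S i).1 ≠ f (S j).1 := by
    intro i j hij
    have hmap := Measure.infinitePi_map_eval_prod (P := fun _ : Fin n => P) hij
    rw [Measure.infinitePi_eq_pi] at hmap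
    have hms : MeasurableSet {w : (𝒳 × Fin 2) × (𝒳 × Fin 2) | f w.1.1 = f w.2.1} :=
      measurableSet_eq_fun (hf.comp (measurable_fst.comp measurable_fst))
        (hf.comp (measurable_fst.comp measurable_snd))
    have h0 : (P.prod P) {w | f w.1.1 = f w.2.1} = 0 := by
      rw [Measure.measure_prod_null hms]
      refine Eventually.of_forall fun z => ?_
      have := ht (f z.1)
      simp_rw [eq_comm (b := f z.1)] at this
      exact this
    rw [← hmap, Measure.map_apply (by fun_prop) hms] at h0
    rw [ae_iff]
    simp only [ne_eq, not_not]
    exact h0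
  have hall : ∀ᵐ S : Dataset 𝒳 n ∂(Measure.pi fun _ => P),
      ∀ i j : Fin n, i ≠ j → f (S i).1 ≠ f (S j).1 := by
    refine ae_all_iff.2 fun i => ae_all_iff.2 fun j => ?_
    by_cases hij : i = j
    · exact Eventually.of_forall fun S h => absurd hij h
    · filter_upwards [hne i j hij] with S hS _ using hS
  filter_upwards [hall] with S hS i j hij
  by_contra hcon
  exact hS i j hcon (congrArg f hij)

lemma integrable_NDCG {f : 𝒳 → ℝ} (hf : Measurable f) (ht : ∀ t, P {z | f z.1 = t} = 0)
    (n : ℕ) :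
    Integrable (fun S : Dataset 𝒳 n => NDCG logDiscount f n S) (Measure.pi fun _ => P) := by
  have hI : AEStronglyMeasurable (fun S : Dataset 𝒳 n => IDCG logDiscount n S)
      (Measure.pi fun _ => P) := by
    have hm : Measurable fun S : Dataset 𝒳 n =>
        ⨆ σ : Equiv.Perm (Fin n), permDCG logDiscount σ S :=
      Measurable.iSup fun σ => measurable_permDCG logDiscount σ
    refine hm.aestronglyMeasurable.congr ?_
    filter_upwards [ae_injective hf ht n] with S hS
    exact (IDCG_eq_of_injective logDiscount hS).symm
  refine Integrable.of_bound (C := 1)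
    ((measurable_DCG logDiscount hf n).aestronglyMeasurable.div₀ hI) ?_
  refine Eventually.of_forall fun S => ?_
  rw [Real.norm_of_nonneg (NDCG_nonneg f S)]
  exact NDCG_le_one f S

end Ranking

/-! ### Comparison of NDCG's -/

namespace Ranking

variable {𝒳 : Type*} [MeasurableSpace 𝒳] {P : Measure (𝒳 × Fin 2)} [IsProbabilityMeasure P]

/-- The NDCG's differ by at least `d` off the atypical event `B`, and by at least `-1` on it. -/
lemma eventually_integral_NDCG_lt {f g : 𝒳 → ℝ} (hf : Measurable f)
    (htf : ∀ t, P {z | f z.1 = t} = 0) (hg : Measurable g)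
    (htg : ∀ t, P {z | g z.1 = t} = 0) {k : ℕ} {a : ℝ} (ha : 0 < a)
    (h : ∀ᶠ n : ℕ in atTop, (Measure.pi fun _ : Fin n => P).real
      {S | DCG logDiscount f n S - DCG logDiscount g n S < n * (a / Real.log n ^ k)}
        ≤ failureBound n) :
    ∀ᶠ n : ℕ in atTop, ∫ S : Dataset 𝒳 n, NDCG logDiscount g n S ∂(Measure.pi fun _ => P)
      < ∫ S : Dataset 𝒳 n, NDCG logDiscount f n S ∂(Measure.pi fun _ => P) := by
  have hD := logDiscount_pos le_rfl
  filter_upwards [h, eventually_ge_atTop 2, isNegligible_failureBound.2 1,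
    eventually_rpow_le_div_log_pow k (a := 1) (b := a / logDiscount 1 / 2) (by positivity)]
    with n h1 hn2 h2 h3
  have hn2' : (2 : ℝ) ≤ n := by exact_mod_cast hn2
  have hn0 : (0 : ℝ) < n := by linarith
  have hlog : 0 < Real.log n := Real.log_pos (by linarith)
  set B : Set (Dataset 𝒳 n) :=
    {S | DCG logDiscount f n S - DCG logDiscount g n S < n * (a / Real.log n ^ k)} with hB
  set d : ℝ := a / Real.log n ^ k / logDiscount 1 with hd
  have hd0 : 0 < d := by positivity
  have hBm : MeasurableSet B :=
    measurableSet_lt ((measurable_DCG _ hf n).sub (measurable_DCG _ hg n)) measurable_const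
  have hfn1 : failureBound n < 1 / 2 := by
    refine h2.trans_le ?_
    rw [Real.rpow_neg_one, ← one_div]
    exact one_div_le_one_div_of_le two_pos hn2'
  have hfn2 : failureBound n < d / 2 := by
    refine h2.trans_le ?_
    have h4 : 1 ≤ n * (d / 2) := by
      calc (1 : ℝ) ≤ 1 * (n : ℝ) ^ (3 / 4 : ℝ) := by
            rw [one_mul]; exact Real.one_le_rpow (by linarith) (by norm_num)
        _ ≤ _ := h3
        _ = n * (d / 2) := by rw [hd]; ring
    rw [Real.rpow_neg_one, inv_le_iff_one_le_mul₀ hn0, mul_comm]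
    exact h4
  have hlow : ∀ S : Dataset 𝒳 n, d - (d + 1) * B.indicator 1 S
      ≤ NDCG logDiscount f n S - NDCG logDiscount g n S := by
    intro S
    by_cases hS : S ∈ B
    · rw [indicator_of_mem hS, Pi.one_apply]
      linarith [NDCG_nonneg f S, NDCG_le_one g S]
    · rw [indicator_of_notMem hS, mul_zero, sub_zero]
      exact le_NDCG_sub_NDCG (by positivity) (not_lt.1 hS) (by omega)
  have hIB : Integrable (fun S => (d + 1) * B.indicator (1 : Dataset 𝒳 n → ℝ) S)
      (Measure.pi fun _ : Fin n => P) :=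
    ((integrable_const (1 : ℝ)).indicator hBm).const_mul _
  have hle := integral_mono ((integrable_const d).sub hIB)
    ((integrable_NDCG hf htf n).sub (integrable_NDCG hg htg n)) hlow
  have hv : ∫ S, (d - (d + 1) * B.indicator (1 : Dataset 𝒳 n → ℝ) S)
      ∂(Measure.pi fun _ : Fin n => P) = d - (d + 1) * (Measure.pi fun _ : Fin n => P).real B := by
    rw [integral_sub (integrable_const d) hIB, integral_const_mul, integral_indicator_one hBm]
    simp
  have hsub : ∫ S : Dataset 𝒳 n, (NDCG logDiscount f n S - NDCG logDiscount g n S)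
      ∂(Measure.pi fun _ => P) = _ :=
    integral_sub (integrable_NDCG hf htf n) (integrable_NDCG hg htg n)
  simp only [Pi.sub_apply] at hle
  rw [hv, hsub] at hle
  have h5 : (d + 1) * (Measure.pi fun _ : Fin n => P).real B ≤ (d + 1) * failureBound n :=
    mul_le_mul_of_nonneg_left h1 (by positivity)
  nlinarith

/-- A union bound over all sample sizes `n ≥ N`. The good event need not be measurable: only the outer
measure of its complement is estimated. -/
lemma eventually_measure_forall_NDCG_lt_ge {f g : 𝒳 → ℝ} {k : ℕ} {a : ℝ} (ha : 0 < a)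
    (h : ∀ᶠ n : ℕ in atTop, (Measure.pi fun _ : Fin n => P).real
      {S | DCG logDiscount f n S - DCG logDiscount g n S < n * (a / Real.log n ^ k)}
        ≤ failureBound n) (hf : Measurable f) (hg : Measurable g) :
    ∀ᶠ N : ℕ in atTop, 1 - ∑' n, failureBound (n + N) ≤
      (Measure.infinitePi fun _ : ℕ => P).real
        {z | ∀ n ≥ N, NDCG logDiscount g n (firstN z n) < NDCG logDiscount f n (firstN z n)} := by
  obtain ⟨N₀, hN₀⟩ := eventually_atTop.1 h
  filter_upwards [eventually_ge_atTop N₀, eventually_ge_atTop 2] with N hN hN2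
  set μ := Measure.infinitePi fun _ : ℕ => P
  set G : Set (ℕ → 𝒳 × Fin 2) :=
    {z | ∀ n ≥ N, NDCG logDiscount g n (firstN z n) < NDCG logDiscount f n (firstN z n)} with hG
  set B : (n : ℕ) → Set (Dataset 𝒳 n) := fun n =>
    {S | DCG logDiscount f n S - DCG logDiscount g n S < n * (a / Real.log n ^ k)} with hB
  have hBm : ∀ n, MeasurableSet (B n) := fun n =>
    measurableSet_lt ((measurable_DCG _ hf n).sub (measurable_DCG _ hg n)) measurable_const
  have hsub : Gᶜ ⊆ ⋃ m : ℕ, (fun z => firstN z (m + N)) ⁻¹' B (m + N) := by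
    intro z hz
    have hz' : ¬ ∀ n ≥ N, NDCG logDiscount g n (firstN z n)
      < NDCG logDiscount f n (firstN z n) := hz
    push Not at hz'
    obtain ⟨n, hn, hle⟩ := hz'
    obtain ⟨m, rfl⟩ := Nat.exists_eq_add_of_le' hn
    refine mem_iUnion.2 ⟨m, ?_⟩
    by_contra hcon
    have hlog : 0 < Real.log ((m + N : ℕ) : ℝ) :=
      Real.log_pos (by exact_mod_cast (by omega : 1 < m + N))
    have h1 := le_NDCG_sub_NDCG (δ := a / Real.log ((m + N : ℕ) : ℝ) ^ k) (by positivity)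
      (not_lt.1 hcon) (by omega)
    have h2 : 0 < a / Real.log ((m + N : ℕ) : ℝ) ^ k / logDiscount 1 :=
      div_pos (by positivity) (logDiscount_pos le_rfl)
    linarith
  have hsum : Summable fun m => failureBound (m + N) :=
    (summable_nat_add_iff N).2 isNegligible_failureBound.summable
  have hcompl : μ Gᶜ ≤ ENNReal.ofReal (∑' m, failureBound (m + N)) := by
    rw [ENNReal.ofReal_tsum_of_nonneg (fun m => isNegligible_failureBound.1 _) hsum]
    refine (measure_mono hsub).trans ((measure_iUnion_le _).trans ?_)
    refine ENNReal.tsum_le_tsum fun m => ?_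
    rw [← Measure.map_apply (measurable_firstN _) (hBm _), map_firstN, ← ofReal_measureReal]
    exact ENNReal.ofReal_le_ofReal (hN₀ (m + N) (by omega))
  have hcompl' : μ.real Gᶜ ≤ ∑' m, failureBound (m + N) :=
    ENNReal.toReal_le_of_le_ofReal (tsum_nonneg fun m => isNegligible_failureBound.1 _) hcompl
  have huniv : μ.real univ ≤ μ.real G + μ.real Gᶜ := by
    rw [← union_compl_self G]
    exact measureReal_union_le _ _
  rw [probReal_univ] at huniv
  linarith

end Ranking

theorem theorem14 {𝒳 : Type*} [MeasurableSpace 𝒳]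
    (P : Measure (𝒳 × Fin 2)) [IsProbabilityMeasure P]
    (hp : 0 < P.real {z | z.2 = 1})
    (f : Fin 2 → 𝒳 → ℝ) (hf : ∀ i, Measurable (f i))
    (hties : ∀ i, ∀ t : ℝ, P {z | f i z.1 = t} = 0)
    (y : Fin 2 → ℝ → ℝ) (hy : ∀ i, Ranking.IsRelevanceCurve P (f i) (y i))
    (hne : ¬ ∀ᵐ s ∂(volume.restrict (Set.Icc (0 : ℝ) 1)), y 0 s = y 1 s) :
    Ranking.DistinguishableInExpectation P (Ranking.NDCG Ranking.logDiscount) f ∧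
    ((∀ i, Ranking.IsHolderOnUnitInterval (y i)) →
      Ranking.ConsistentlyDistinguishable P (Ranking.NDCG Ranking.logDiscount) f) := by
  open Ranking in
  obtain ⟨k, c, hc0, hc⟩ := exists_tendsto_discounted_sum
    (lipschitzWith_topMass_sub (hf 0) (hties 0) (hf 1) (hties 1))
    (by simp only [topMass_zero (hf _) (hties _), sub_self])
    (fun t ht => by simp only [topMass_of_one_le _ ht, sub_self])
    (by
      by_contra! hcon
      exact hne (relevanceCurve_ae_eq (hf 0) (hties 0) (hf 1) (hties 1) (hy 0) (hy 1)
        fun t ht => sub_eq_zero.1 (hcon t ht)))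
  obtain ⟨b, a, ha, hb⟩ : ∃ (b : Fin 2) (a : ℝ), 0 < a ∧ ∀ᶠ n : ℕ in atTop,
      (Measure.pi fun _ : Fin n => P).real
        {S | DCG logDiscount (f b) n S - DCG logDiscount (f (1 - b)) n S
          < n * (a / Real.log n ^ k)} ≤ failureBound n := by
    rcases hc0.lt_or_gt with hneg | hpos
    · refine ⟨1, exists_measure_DCG_sub_lt_le (hf 1) (hties 1) (hf 0) (hties 0)
        (neg_pos.2 hneg) (hc.neg.congr fun n => ?_)⟩
      rw [← mul_neg, ← Finset.sum_neg_distrib]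
      congr 1
      exact Finset.sum_congr rfl fun q _ => by ring
    · exact ⟨0, exists_measure_DCG_sub_lt_le (hf 0) (hties 0) (hf 1) (hties 1) hpos hc⟩
  constructor
  · obtain ⟨N, hN⟩ := eventually_atTop.1 (eventually_integral_NDCG_lt (hf b) (hties b)
      (hf (1 - b)) (hties (1 - b)) ha hb)
    exact ⟨b, N + 1, Nat.succ_pos N, fun n hn =>
      ⟨fun i => integrable_NDCG (hf i) (hties i) n, hN n (by omega)⟩⟩
  · intro _
    exact ⟨fun N => ∑' n, failureBound (n + N), b, isNegligible_failureBound.tail,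
      eventually_measure_forall_NDCG_lt_ge ha hb (hf b) (hf (1 - b))⟩
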